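/- Let $G$ be a finite group, let $A$ be a simple unital C*-algebra, let $\alpha\colon G\to\mathrm{Aut}(A)$ be an action, let $n\ge 1$, and let $\beta\colon G\to \mathrm{Aut}(M_n)$ be an arbitrary action of $G$ on the complex $n\times n$ matrices. Let $\alpha\otimes\beta$ be the action of $G$ on $A\otimes M_n=M_n(A)$ determined by $(\alpha\otimes\beta)_g(a\otimes b)=\alpha_g(a)\otimes\beta_g(b)$. Then: (a) $\alpha$ has the tracial Rokhlin property if and only if $\alpha\otimes\beta$ has the tracial Rokhlin property; (b) $\alpha$ has the Rokhlin property if and only if $\alpha\otimes\beta$ has the Rokhlin property. Here an action $\gamma\colon G\to\mathrm{Aut}(B)$ on a unital C*-algebra $B$ has the Rokhlin property if for every finite set $F\subset B$ and every $\varepsilon>0$ there are mutually orthogonal projections $e_g\in B$, $g\in G$, such that (1) $\|\gamma_g(e_h)-e_{gh}\|<\varepsilon$ for all $g,h\in G$; (2) $\|e_ga-ae_g\|<\varepsilon$ for all $g\in G$ and $a\in F$; (3) $\sum_{g\in G}e_g=1$. It has the tracial Rokhlin property if for every finite set $F\subset B$, every $\varepsilon>0$ and every positive $x\in B$ with $\|x\|=1$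 there are mutually orthogonal projections $e_g\in B$, $g\in G$, such that (1) and (2) hold and, with $e=\sum_{g\in G}e_g$, the projection $1-e$ is Murray-von Neumann equivalent to a projection in the hereditary subalgebra $\overline{xBx}$ of $B$ generated by $x$, and $\|exe\|>1-\varepsilon$. -/

import Mathlib

open scoped TensorProduct

noncomputable section

/-- A C⋆-algebra is simple if it is nonzero and its only closed two-sided ideals are `0` and
the whole algebra. -/
def IsSimpleCStarAlgebra (A : Type*) [CStarAlgebra A] : Prop :=
  Nontrivial A ∧ ∀ I : TwoSidedIdeal A, IsClosed (I : Set A) → I = ⊥ ∨ I = ⊤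

/-- The hereditary C⋆-subalgebra of `A` generated by a positive element `x`, as a set: the norm
closure of `x A x`. -/
def hereditarySet {A : Type*} [CStarAlgebra A] (x : A) : Set A :=
  closure (Set.range fun a : A => x * a * x)

/-- Murray-von Neumann equivalence of two projections `p` and `q`: there is a partial isometry
`v` with `v⋆v = p` and `vv⋆ = q`. -/
def MvNEquiv {A : Type*} [CStarAlgebra A] (p q : A) : Prop :=
  ∃ v : A, star v * v = p ∧ v * star v = q

/-- The Rokhlin property of an action `α` of a finite group `G` on a unital C⋆-algebra `A`. -/
def RokhlinProperty {G A : Type*} [Group G] [Fintype G] [CStarAlgebra A]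
    (α : G →* (A ≃⋆ₐ[ℂ] A)) : Prop :=
  ∀ (F : Finset A) (ε : ℝ), 0 < ε →
    ∃ e : G → A,
      (∀ g, IsStarProjection (e g)) ∧
      (∀ g h, g ≠ h → e g * e h = 0) ∧
      (∀ g h, ‖α g (e h) - e (g * h)‖ < ε) ∧
      (∀ g, ∀ a ∈ F, ‖e g * a - a * e g‖ < ε) ∧
      ∑ g, e g = 1

/-- The tracial Rokhlin property of an action `α` of a finite group `G` on a (simple) unital
C⋆-algebra `A`. -/
def TracialRokhlinProperty {G A : Type*} [Group G] [Fintype G] [CStarAlgebra A]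
    [PartialOrder A] [StarOrderedRing A] (α : G →* (A ≃⋆ₐ[ℂ] A)) : Prop :=
  ∀ (F : Finset A) (ε : ℝ), 0 < ε → ∀ x : A, 0 ≤ x → ‖x‖ = 1 →
    ∃ e : G → A,
      (∀ g, IsStarProjection (e g)) ∧
      (∀ g h, g ≠ h → e g * e h = 0) ∧
      (∀ g h, ‖α g (e h) - e (g * h)‖ < ε) ∧
      (∀ g, ∀ a ∈ F, ‖e g * a - a * e g‖ < ε) ∧
      (∃ q ∈ hereditarySet x, IsStarProjection q ∧ MvNEquiv (1 - ∑ g, e g) q) ∧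
      1 - ε < ‖(∑ g, e g) * x * (∑ g, e g)‖

section TensorAction

variable {G A : Type*} [Group G] [CStarAlgebra A] {n : Type*} [Fintype n] [DecidableEq n]

/-- The matrix over `A` corresponding to the elementary tensor `a ⊗ b` in `A ⊗ M_n`. -/
def elemTensor (a : A) (b : Matrix n n ℂ) : CStarMatrix n n A :=
  CStarMatrix.ofMatrix (Matrix.of fun i j => b i j • a)

/-- The automorphism `φ ⊗ ψ` of `A ⊗ M_n`, transported to `M_n(A)` along the canonical
isomorphism `M_n(A) ≅ A ⊗ M_n`, as an algebra automorphism. -/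
def tensorAlgAut (φ : A ≃⋆ₐ[ℂ] A) (ψ : Matrix n n ℂ ≃⋆ₐ[ℂ] Matrix n n ℂ) :
    Matrix n n A ≃ₐ[ℂ] Matrix n n A :=
  ((matrixEquivTensor n ℂ A).trans
    (Algebra.TensorProduct.congr φ.toAlgEquiv ψ.toAlgEquiv)).trans (matrixEquivTensor n ℂ A).symm

theorem matrixEquivTensor_symm_tmul (a : A) (b : Matrix n n ℂ) :
    (matrixEquivTensor n ℂ A).symm (a ⊗ₜ b) = Matrix.of fun i j => b i j • a := by
  ext i j
  simp [Algebra.smul_def, Algebra.commutes]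

theorem tensorAlgAut_tmul (φ : A ≃⋆ₐ[ℂ] A) (ψ : Matrix n n ℂ ≃⋆ₐ[ℂ] Matrix n n ℂ)
    (a : A) (b : Matrix n n ℂ) :
    tensorAlgAut φ ψ (Matrix.of fun i j => b i j • a) = Matrix.of fun i j => ψ b i j • φ a := by
  rw [← matrixEquivTensor_symm_tmul, ← matrixEquivTensor_symm_tmul]
  simp only [tensorAlgAut, AlgEquiv.trans_apply, AlgEquiv.apply_symm_apply]
  rfl

theorem matrix_tensor_induction {P : Matrix n n A → Prop}
    (hadd : ∀ X Y, P X → P Y → P (X + Y)) (h0 : P 0)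
    (h : ∀ (a : A) (b : Matrix n n ℂ), P (Matrix.of fun i j => b i j • a)) (X : Matrix n n A) :
    P X := by
  obtain ⟨t, rfl⟩ := (matrixEquivTensor n ℂ A).symm.surjective X
  induction t using TensorProduct.induction_on with
  | zero => simpa only [map_zero] using h0
  | tmul a b => rw [matrixEquivTensor_symm_tmul]; exact h a b
  | add s t hs ht => rw [map_add]; exact hadd _ _ hs ht

theorem star_of_smul (a : A) (b : Matrix n n ℂ) :
    star (Matrix.of fun i j => b i j • a) = Matrix.of fun i j => star b i j • star a := by
  ext i j
  simp [Matrix.star_apply]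

theorem tensorAlgAut_star (φ : A ≃⋆ₐ[ℂ] A) (ψ : Matrix n n ℂ ≃⋆ₐ[ℂ] Matrix n n ℂ)
    (X : Matrix n n A) : tensorAlgAut φ ψ (star X) = star (tensorAlgAut φ ψ X) := by
  induction X using matrix_tensor_induction with
  | hadd X Y hX hY => rw [star_add, map_add, map_add, star_add, hX, hY]
  | h0 => simp
  | h a b => rw [star_of_smul, tensorAlgAut_tmul, tensorAlgAut_tmul, star_of_smul, map_star, map_star]

/-- The ⋆-automorphism `φ ⊗ ψ` of the C⋆-algebra `A ⊗ M_n = M_n(A)`. -/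
def tensorAut (φ : A ≃⋆ₐ[ℂ] A) (ψ : Matrix n n ℂ ≃⋆ₐ[ℂ] Matrix n n ℂ) :
    CStarMatrix n n A ≃⋆ₐ[ℂ] CStarMatrix n n A :=
  (CStarMatrix.ofMatrixStarAlgEquiv.symm.trans
    (StarAlgEquiv.ofAlgEquiv (tensorAlgAut φ ψ) (tensorAlgAut_star φ ψ))).trans
      CStarMatrix.ofMatrixStarAlgEquiv

theorem tensorAut_elemTensor (φ : A ≃⋆ₐ[ℂ] A) (ψ : Matrix n n ℂ ≃⋆ₐ[ℂ] Matrix n n ℂ)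
    (a : A) (b : Matrix n n ℂ) : tensorAut φ ψ (elemTensor a b) = elemTensor (φ a) (ψ b) :=
  tensorAlgAut_tmul φ ψ a b

theorem starAlgEquiv_ext_elemTensor {φ ψ : CStarMatrix n n A ≃⋆ₐ[ℂ] CStarMatrix n n A}
    (h : ∀ (a : A) (b : Matrix n n ℂ), φ (elemTensor a b) = ψ (elemTensor a b)) : φ = ψ := by
  ext1 X
  refine matrix_tensor_induction (P := fun X => φ (CStarMatrix.ofMatrix X) =
    ψ (CStarMatrix.ofMatrix X)) ?_ ?_ h X
  · intro X Y hX hY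
    exact (map_add φ _ _).trans ((congrArg₂ (· + ·) hX hY).trans (map_add ψ _ _).symm)
  · exact (map_zero φ).trans (map_zero ψ).symm

/-- The tensor product action `α ⊗ β` of `G` on `A ⊗ M_n = M_n(A)`, determined by
`(α ⊗ β)_g (a ⊗ b) = α_g(a) ⊗ β_g(b)`. -/
def tensorAction (α : G →* (A ≃⋆ₐ[ℂ] A)) (β : G →* (Matrix n n ℂ ≃⋆ₐ[ℂ] Matrix n n ℂ)) :
    G →* (CStarMatrix n n A ≃⋆ₐ[ℂ] CStarMatrix n n A) where
  toFun g := tensorAut (α g) (β g)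
  map_one' := starAlgEquiv_ext_elemTensor fun a b => by
    rw [tensorAut_elemTensor, map_one, map_one]; rfl
  map_mul' g h := starAlgEquiv_ext_elemTensor fun a b => by
    rw [tensorAut_elemTensor, map_mul, map_mul, StarAlgEquiv.mul_apply, StarAlgEquiv.mul_apply,
      StarAlgEquiv.mul_apply, tensorAut_elemTensor, tensorAut_elemTensor]

theorem tensorAction_elemTensor (α : G →* (A ≃⋆ₐ[ℂ] A))
    (β : G →* (Matrix n n ℂ ≃⋆ₐ[ℂ] Matrix n n ℂ)) (g : G) (a : A) (b : Matrix n n ℂ) :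
    tensorAction α β g (elemTensor a b) = elemTensor (α g a) (β g b) :=
  tensorAut_elemTensor (α g) (β g) a b

end TensorAction

end

/-! Since `β_g(1) = 1`, elements `a ⊗ 1` are moved by `α` alone, so Rokhlin projections `e_g` for
`α` give Rokhlin projections `e_g ⊗ 1` for `α ⊗ β`. Conversely, an element of `M_n(A)` that almost
commutes with the matrix units is close to its `(k,k)` entry tensored with `1`. A Rokhlin net for `α
⊗ β` is therefore close to one of the form `p_g ⊗ 1`, once the entries are perturbed to orthogonal
projections (`exists_orthogonal_projections`, `IsRokhlinNet.exists_elemTensor_one`). This settles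
the Rokhlin property; for the tracial descent to `α` one tests against `x ⊗ e_kk` and compresses to
the corner of `e_kk`. None of this uses simplicity.

The remaining direction is the tracial ascent: the remainder `(1 - e) ⊗ 1` consists of `n` copies of
`1 - e`, all of which must fit under a given positive `X` in `M_n(A)`. If `α` has the Rokhlin
property there is nothing to fit. Otherwise `A` has property (SP), because the remainders cannot
vanish, and it has no minimal projection: below one, every `e` would be asymptotically scalar, hence
by simplicity scalar on `A`, hence `1`. Thus every nonzero projection of `A` contains `n` orthogonal
equivalent copies of some nonzero `p`. They are placed under a spectral cutdown of `X` near its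
norm, and the tracial Rokhlin property of `α` is applied with `x = p`. The cutdown near the top also
yields the norm condition. -/

open Filter Topology

noncomputable section

/-- The closed right ideal of a C⋆-algebra generated by an element. -/
def closedRightIdeal {A : Type*} [CStarAlgebra A] (x : A) : Set A :=
  closure (Set.range fun a : A => x * a)

/-! ### Projections, closed right ideals and subequivalence -/

section Algebra

variable {A : Type*} [CStarAlgebra A]

theorem mul_mem_closedRightIdeal {x y : A} (hy : y ∈ closedRightIdeal x) (a : A) :
    y * a ∈ closedRightIdeal x :=
  map_mem_closure (f := fun z => z * a) (continuous_mul_const a) hy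
    fun _ ⟨b, hb⟩ => ⟨b * a, by simp [← hb, mul_assoc]⟩

theorem mul_self_mem_closedRightIdeal (x a : A) : x * a ∈ closedRightIdeal x :=
  subset_closure ⟨a, rfl⟩

theorem mul_eq_self_of_mem_closedRightIdeal {b x y : A} (hb : b * x = x)
    (hy : y ∈ closedRightIdeal x) : b * y = y := by
  have hc : IsClosed {z : A | b * z = z} := isClosed_eq (continuous_const_mul b) continuous_id
  refine closure_minimal ?_ hc hy
  rintro _ ⟨a, rfl⟩
  simp only [Set.mem_ofPred_eq, ← mul_assoc, hb]

theorem exists_norm_mul_sub_lt_one {x y : A} (hy : y ∈ closedRightIdeal x) :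
    ∃ m, ‖x * m - y‖ < 1 := by
  obtain ⟨_, ⟨m, rfl⟩, h⟩ := Metric.mem_closure_iff.1 hy 1 one_pos
  exact ⟨m, by rwa [dist_comm, dist_eq_norm] at h⟩

theorem isUnit_of_norm_sub_one_lt {y : A} (h : ‖y - 1‖ < 1) : IsUnit y := by
  have h' : ‖1 - y‖ < 1 := by rwa [norm_sub_rev]
  simpa using (Units.oneSub (1 - y) h').isUnit

theorem IsStarProjection.star_eq {p : A} (hp : IsStarProjection p) : star p = p :=
  hp.isSelfAdjoint.star_eq

theorem IsStarProjection.mul_self {p : A} (hp : IsStarProjection p) : p * p = p :=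
  hp.isIdempotentElem

theorem isStarProjection_of {p : A} (h₁ : p * p = p) (h₂ : star p = p) : IsStarProjection p :=
  ⟨h₁, h₂⟩

theorem IsStarProjection.norm_eq_one {p : A} (hp : IsStarProjection p) (h : p ≠ 0) : ‖p‖ = 1 := by
  have h1 : ‖p‖ * ‖p‖ = ‖p‖ := by
    rw [← CStarRing.norm_star_mul_self, hp.star_eq, hp.mul_self]
  exact mul_left_cancel₀ (norm_ne_zero_iff.2 h) (by rw [h1, mul_one])

theorem IsStarProjection.eq_zero_of_norm_lt {p : A} (hp : IsStarProjection p) (h : ‖p‖ < 1) :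
    p = 0 := by
  by_contra h0
  exact h.ne (hp.norm_eq_one h0)

theorem mul_eq_self_of_star_mul_self {v p : A} (hp : IsStarProjection p) (hv : star v * v = p) :
    v * p = v := by
  rw [← sub_eq_zero, ← CStarRing.star_mul_self_eq_zero_iff]
  simp only [star_sub, star_mul, hp.star_eq]
  calc (p * star v - star v) * (v * p - v)
      = p * (star v * v) * p - p * (star v * v) - (star v * v) * p + star v * v := by noncomm_ring
    _ = 0 := by rw [hv]; simp [hp.mul_self]

/-- The identities `v = (v v⋆) v` and `(x a)(x a)⋆ = x (a a⋆) x` pass between the two sides. The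
right ideal form is the convenient one: it survives multiplication on the right by further partial
isometries. -/
theorem exists_mem_hereditarySet_iff {x p : A} (hx : IsSelfAdjoint x) (hp : IsStarProjection p) :
    (∃ q ∈ hereditarySet x, IsStarProjection q ∧ MvNEquiv p q) ↔
      ∃ v ∈ closedRightIdeal x, star v * v = p := by
  constructor
  · rintro ⟨q, hqx, -, v, hv, rfl⟩
    refine ⟨v, ?_, hv⟩
    have h1 : v * star v ∈ closedRightIdeal x :=
      closure_mono (by rintro _ ⟨a, rfl⟩; exact ⟨a * x, by simp [mul_assoc]⟩) hqx
    have h2 := mul_mem_closedRightIdeal h1 v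
    rwa [mul_assoc, hv, mul_eq_self_of_star_mul_self hp hv] at h2
  · rintro ⟨v, hvx, hv⟩
    refine ⟨v * star v, ?_, ?_, v, hv, rfl⟩
    · refine map_mem_closure (f := fun v => v * star v) (by fun_prop) hvx ?_
      rintro _ ⟨a, rfl⟩
      exact ⟨a * star a, by simp [mul_assoc, hx.star_eq]⟩
    · refine isStarProjection_of ?_ (by simp)
      rw [mul_assoc, ← mul_assoc (star v), hv, ← mul_assoc, mul_eq_self_of_star_mul_self hp hv]

theorem IsStarProjection.sum {ι : Type*} [DecidableEq ι] {e : ι → A} (s : Finset ι)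
    (h : ∀ i ∈ s, IsStarProjection (e i)) (h' : ∀ i ∈ s, ∀ j ∈ s, i ≠ j → e i * e j = 0) :
    IsStarProjection (∑ i ∈ s, e i) := by
  refine isStarProjection_of ?_ ?_
  · rw [Finset.sum_mul_sum]
    refine Finset.sum_congr rfl fun i hi => ?_
    rw [Finset.sum_eq_single_of_mem i hi fun j hj hij => h' i hi j hj hij.symm, (h i hi).mul_self]
  · rw [star_sum]
    exact Finset.sum_congr rfl fun i hi => (h i hi).star_eq

end Algebra

/-! ### Partial isometries from polar decomposition -/

section Order

variable {A : Type*} [CStarAlgebra A] [PartialOrder A] [StarOrderedRing A]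

/-- If `b` is left invertible on the projection `p` up to an error of norm less than one, then
the polar decomposition of `b * p` produces a partial isometry with initial projection `p`. -/
theorem exists_star_mul_self_eq {p b m : A} (hp : IsStarProjection p) (h : ‖m * b * p - p‖ < 1) :
    ∃ c, star (b * p * c) * (b * p * c) = p := by
  set t := p * star b * b * p + (1 - p) with ht
  have hp1 : 0 ≤ 1 - p := hp.one_sub.nonneg
  have hbb : 0 ≤ p * star b * b * p := by
    simpa [hp.star_eq, mul_assoc] using star_mul_self_nonneg (b * p)
  have ht0 : 0 ≤ t := add_nonneg hbb hp1
  have htp : Commute t p := by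
    simp only [Commute, SemiconjBy, ht, add_mul, mul_add, sub_mul, mul_sub, mul_assoc, hp.mul_self,
      one_mul, mul_one, sub_self]
    simp only [← mul_assoc, hp.mul_self]
  have hy : IsUnit (p * m * b * p + (1 - p)) := by
    refine isUnit_of_norm_sub_one_lt ?_
    have : p * m * b * p + (1 - p) - 1 = p * (m * b * p - p) := by
      rw [mul_sub, hp.mul_self]; noncomm_ring
    rw [this]
    exact (norm_mul_le _ _).trans_lt ((mul_le_of_le_one_left (norm_nonneg _) hp.norm_le).trans_lt h)
  have htu : IsStrictlyPositive t := by
    set y := p * m * b * p + (1 - p) with hy'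
    have hyy : IsStrictlyPositive (star y * y) := by
      rw [IsStrictlyPositive.iff_of_unital]
      exact ⟨star_mul_self_nonneg _, hy.star.mul hy⟩
    -- The invertible `y` transfers strict positivity to `t`: `‖m‖²` bounds the `p` corner, and the
    -- extra `1` covers `1 - p` even when `m` is small.
    have hyt : star y * y ≤ (‖m‖ ^ 2 + 1) • t := by
      have e1 : star y * y = p * star b * (star m * p * m) * (b * p) + (1 - p) := by
        simp only [hy', star_add, star_mul, star_sub, star_one, hp.star_eq]
        have h1 : p * (1 - p) = 0 := hp.mul_one_sub_self
        have h2 : (1 - p) * p = 0 := hp.one_sub_mul_self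
        have h3 : (1 - p) * (1 - p) = 1 - p := hp.one_sub.mul_self
        have h4 := hp.mul_self
        calc _ = p * star b * (star m * (p * p) * m) * (b * p)
              + p * (star b * (star m * (p * (1 - p)))) + ((1 - p) * p) * (m * (b * p))
              + (1 - p) * (1 - p) := by noncomm_ring
          _ = _ := by rw [h1, h2, h3, h4]; simp
      have e2 : star m * p * m ≤ algebraMap ℝ A (‖m‖ ^ 2) := by
        refine le_trans ?_ CStarAlgebra.star_mul_le_algebraMap_norm_sq
        have := star_left_conjugate_le_conjugate hp.le_one m
        simpa using this
      have e3 := star_left_conjugate_le_conjugate e2 (b * p)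
      rw [e1, ht, smul_add, add_smul, one_smul, add_smul, one_smul]
      have e4 : star (b * p) * algebraMap ℝ A (‖m‖ ^ 2) * (b * p)
          = ‖m‖ ^ 2 • (p * star b * b * p) := by
        simp [Algebra.algebraMap_eq_smul_one, hp.star_eq, mul_assoc]
      rw [e4, star_mul, hp.star_eq] at e3
      have e5 : 0 ≤ ‖m‖ ^ 2 • (1 - p) := smul_nonneg (by positivity) hp1
      calc _ ≤ ‖m‖ ^ 2 • (p * star b * b * p) + (1 - p) := by gcongr
        _ ≤ (‖m‖ ^ 2 • (p * star b * b * p) + (p * star b * b * p)) +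
            (‖m‖ ^ 2 • (1 - p) + (1 - p)) :=
          add_le_add (le_add_of_nonneg_right hbb) (le_add_of_nonneg_left e5)
    have hst := hyy.of_le hyt
    rw [IsStrictlyPositive.iff_of_unital] at hst ⊢
    refine ⟨ht0, ?_⟩
    have hk : (‖m‖ ^ 2 + 1) ≠ 0 := by positivity
    have := hst.2.smul (Units.mk0 (‖m‖ ^ 2 + 1) hk)⁻¹
    rwa [Units.smul_def, Units.val_inv_eq_inv_val, Units.val_mk0, smul_smul, inv_mul_cancel₀ hk,
      one_smul] at this
  set s := t ^ (-(1 / 2) : ℝ)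
  have hs : s * t * s = 1 := CFC.conjugate_rpow_neg_one_half t
  have hs0 : star s = s := (CFC.rpow_nonneg (a := t)).isSelfAdjoint.star_eq
  have hsp : s * p = p * s := by
    have : Commute s p := by
      rw [show s = cfc (fun x : NNReal => x ^ (-(1 / 2) : ℝ)) t from CFC.rpow_def]
      exact htp.cfc_nnreal _
    exact this
  refine ⟨s, ?_⟩
  calc star (b * p * s) * (b * p * s) = s * (p * star b * b * p) * s := by
        simp [hs0, hp.star_eq, mul_assoc]
    _ = p * (s * t * s) := by
        have : p * star b * b * p = p * t := by
          simp only [ht, mul_add, hp.mul_one_sub_self, add_zero, ← mul_assoc, hp.mul_self]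
        rw [this, ← mul_assoc, hsp]; simp only [mul_assoc]
    _ = p := by rw [hs, mul_one]

theorem exists_star_mul_self_eq_of_norm_sub_lt {p q : A} (hp : IsStarProjection p)
    (hq : IsStarProjection q) (h : ‖q - p‖ < 1) : ∃ v, star v * v = p ∧ q * v = v := by
  obtain ⟨c, hc⟩ := exists_star_mul_self_eq (b := q) (m := 1) hp (by
    have : 1 * q * p - p = (q - p) * p := by rw [sub_mul, hp.mul_self, one_mul]
    rw [this]
    exact (norm_mul_le _ _).trans_lt ((mul_le_of_le_one_right (norm_nonneg _) hp.norm_le).trans_lt h))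
  exact ⟨q * p * c, hc, by simp only [← mul_assoc, hq.mul_self]⟩

end Order

/-! ### Perturbing approximate projections to orthogonal projections -/

section Perturbation

variable {A : Type*} [CStarAlgebra A]

/-- The bound `|t² - t| < 1/4` on the spectrum excludes `t = 1/2`, so the indicator of `t ≥ 1/2` is
continuous there. One of `|t|`, `|t - 1|` is at least `1/2`, whence the factor `2`. -/
theorem exists_isStarProjection_near {b : A} (hb : IsSelfAdjoint b) (h : ‖b * b - b‖ < 1 / 4) :
    ∃ p, IsStarProjection p ∧ ‖p - b‖ ≤ 2 * ‖b * b - b‖ ∧ ∀ c, Commute b c → Commute p c := by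
  have hspec : ∀ t ∈ spectrum ℝ b, |t * t - t| ≤ ‖b * b - b‖ := by
    intro t ht
    have h1 : cfc (fun t : ℝ => t * t - t) b = b * b - b := by
      rw [cfc_sub (fun t : ℝ => t * t) (fun t => t) b, cfc_mul (fun t : ℝ => t) (fun t => t) b,
        cfc_id' ℝ b]
    rw [← h1]
    exact norm_apply_le_norm_cfc (fun t : ℝ => t * t - t) b ht
  let f : ℝ → ℝ := fun t => if t < 1 / 2 then 0 else 1
  have hf : ContinuousOn f (spectrum ℝ b) := by
    intro t ht
    refine ContinuousAt.continuousWithinAt ?_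
    have h1 := (hspec t ht).trans_lt h
    rw [abs_lt] at h1
    rcases lt_trichotomy t (1 / 2) with h2 | h2 | h2
    · exact (continuousAt_const (y := (0 : ℝ))).congr
        ((eventually_lt_nhds h2).mono fun s hs => (if_pos hs).symm)
    · subst h2; norm_num at h1
    · exact (continuousAt_const (y := (1 : ℝ))).congr
        ((eventually_gt_nhds h2).mono fun s hs => (if_neg hs.le.not_gt).symm)
  refine ⟨cfc f b, ?_, ?_, fun c hc => hb.commute_cfc hc f⟩
  · refine isStarProjection_of ?_ (cfc_predicate f b).star_eq
    rw [← cfc_mul f f b]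
    congr 1
    ext t
    by_cases ht : t < 1 / 2 <;> simp [f]
  · have h1 : cfc f b - b = cfc (fun t => f t - t) b := by
      rw [cfc_sub f (fun t => t) b, cfc_id' ℝ b]
    rw [h1]
    refine norm_cfc_le (by positivity) fun t ht => ?_
    have h2 := hspec t ht
    rw [Real.norm_eq_abs]
    have h3 : |t * t - t| = |t| * |t - 1| := by rw [← abs_mul]; ring_nf
    by_cases ht : t < 1 / 2
    · have h4 : 1 / 2 ≤ |t - 1| := by rw [abs_of_neg (by linarith)]; linarith
      have h5 : |f t - t| = |t| := by rw [show f t = 0 from if_pos ht, zero_sub, abs_neg]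
      rw [h5]
      nlinarith [abs_nonneg t]
    · have h4 : 1 / 2 ≤ |t| := by rw [abs_of_pos (by linarith)]; linarith
      have h5 : |f t - t| = |t - 1| := by rw [show f t = 1 from if_neg ht, abs_sub_comm]
      rw [h5]
      nlinarith [abs_nonneg (t - 1)]

theorem tendsto_mul_zero_of_bounded {I : Type*} {l : Filter I} {u v : I → A} {C : ℝ}
    (hu : ∀ᶠ i in l, ‖u i‖ ≤ C) (hv : Tendsto v l (𝓝 0)) :
    Tendsto (fun i => u i * v i) l (𝓝 0) ∧ Tendsto (fun i => v i * u i) l (𝓝 0) := by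
  have h := (tendsto_norm_zero.comp hv).const_mul C
  rw [mul_zero] at h
  constructor
  · refine squeeze_zero_norm' (hu.mono fun i hi => ?_) h
    exact (norm_mul_le _ _).trans (mul_le_mul_of_nonneg_right hi (norm_nonneg _))
  · refine squeeze_zero_norm' (hu.mono fun i hi => ?_) h
    rw [Function.comp_apply, mul_comm]
    exact (norm_mul_le _ _).trans (mul_le_mul_of_nonneg_left hi (norm_nonneg _))

/-- Self-adjoint elements which are asymptotically mutually orthogonal projections can be
perturbed to mutually orthogonal projections. -/
theorem exists_orthogonal_projections {I ι : Type*} [DecidableEq ι] {l : Filter I}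
    {a : I → ι → A} (hsa : ∀ᶠ i in l, ∀ g, IsSelfAdjoint (a i g))
    (hbd : ∀ᶠ i in l, ∀ g, ‖a i g‖ ≤ 1)
    (hproj : ∀ g, Tendsto (fun i => a i g * a i g - a i g) l (𝓝 0))
    (horth : ∀ g h, g ≠ h → Tendsto (fun i => a i g * a i h) l (𝓝 0)) (s : Finset ι) :
    ∃ p : I → ι → A,
      (∀ᶠ i in l, (∀ g ∈ s, IsStarProjection (p i g)) ∧
        ∀ g ∈ s, ∀ h ∈ s, g ≠ h → p i g * p i h = 0) ∧
      ∀ g ∈ s, Tendsto (fun i => p i g - a i g) l (𝓝 0) := by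
  induction s using Finset.induction_on with
  | empty => exact ⟨a, by simp, by simp⟩
  | insert k s hk ih =>
    obtain ⟨p, hp, hpa⟩ := ih
    set q : I → A := fun i => ∑ g ∈ s, p i g with hq
    have hqp : ∀ᶠ i in l, IsStarProjection (q i) :=
      hp.mono fun i hi => IsStarProjection.sum s hi.1 hi.2
    -- Compression by `1 - q` makes the new element exactly orthogonal to the projections already
    -- built, at an asymptotically negligible cost.
    set b : I → A := fun i => (1 - q i) * a i k * (1 - q i) with hb
    have hbsa : ∀ᶠ i in l, IsSelfAdjoint (b i) := by
      filter_upwards [hqp, hsa] with i hi hi'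
      simp [isSelfAdjoint_iff, hb, star_sub, hi.star_eq, (hi' k).star_eq, mul_assoc]
    have hak : ∀ᶠ i in l, ‖a i k‖ ≤ 1 := hbd.mono fun i hi => hi k
    have haq : Tendsto (fun i => a i k * q i) l (𝓝 0) := by
      simp only [hq, Finset.mul_sum]
      rw [← Finset.sum_const_zero (s := s)]
      refine tendsto_finsetSum _ fun g hg => ?_
      have h1 := (tendsto_mul_zero_of_bounded hak (hpa g hg)).1.add
        (horth k g (by rintro rfl; exact hk hg))
      simpa [mul_sub] using h1
    have hqa : Tendsto (fun i => q i * a i k) l (𝓝 0) := by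
      have h1 := haq.star
      rw [star_zero] at h1
      refine h1.congr' ?_
      filter_upwards [hqp, hsa] with i hi hi'
      rw [star_mul, hi.star_eq, (hi' k).star_eq]
    have hq1 : ∀ᶠ i in l, ‖q i‖ ≤ 1 := hqp.mono fun i hi => hi.norm_le
    have hba : Tendsto (fun i => b i - a i k) l (𝓝 0) := by
      have h1 := ((tendsto_mul_zero_of_bounded hq1 haq).1.sub haq).sub hqa
      simp only [sub_zero] at h1
      refine h1.congr fun i => ?_
      simp only [hb]; noncomm_ring
    have hb1 : ∀ᶠ i in l, ‖b i‖ ≤ 1 := by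
      filter_upwards [hqp, hak] with i hi hi'
      have h1 := hi.one_sub.norm_le
      calc ‖b i‖ ≤ ‖1 - q i‖ * ‖a i k‖ * ‖1 - q i‖ := norm_mul₃_le
        _ ≤ 1 * 1 * 1 := by gcongr
        _ = 1 := by norm_num
    have hbb : Tendsto (fun i => b i * b i - b i) l (𝓝 0) := by
      have h1 := (((tendsto_mul_zero_of_bounded hb1 hba).1.add
        (tendsto_mul_zero_of_bounded hak hba).2).add (hproj k)).sub hba
      simp only [sub_zero, add_zero] at h1
      refine h1.congr fun i => ?_
      noncomm_ring
    have hev : ∀ᶠ i in l, ‖b i * b i - b i‖ < 1 / 4 :=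
      (tendsto_norm_zero.comp hbb).eventually (gt_mem_nhds (by norm_num))
    have hex : ∀ i, ∃ p, IsSelfAdjoint (b i) → ‖b i * b i - b i‖ < 1 / 4 →
        IsStarProjection p ∧ ‖p - b i‖ ≤ 2 * ‖b i * b i - b i‖ ∧
          ∀ c, Commute (b i) c → Commute p c := by
      intro i
      by_cases h : IsSelfAdjoint (b i) ∧ ‖b i * b i - b i‖ < 1 / 4
      · obtain ⟨p, hp⟩ := exists_isStarProjection_near h.1 h.2
        exact ⟨p, fun _ _ => hp⟩
      · exact ⟨0, fun h1 h2 => (h ⟨h1, h2⟩).elim⟩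
    choose r hr using hex
    have hrb : Tendsto (fun i => r i - b i) l (𝓝 0) := by
      have h1 := (tendsto_norm_zero.comp hbb).const_mul 2
      rw [mul_zero] at h1
      refine squeeze_zero_norm' ?_ h1
      filter_upwards [hbsa, hev] with i hi hi' using (hr i hi hi').2.1
    have hrp : ∀ᶠ i in l, IsStarProjection (r i) ∧ r i * q i = 0 ∧ q i * r i = 0 := by
      filter_upwards [hbsa, hev, hqp] with i h1 h2 h3
      obtain ⟨hpr, hn, hc⟩ := hr i h1 h2
      have hbq : b i * q i = 0 := by simp only [hb, mul_assoc, h3.one_sub_mul_self, mul_zero]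
      have hqb : q i * b i = 0 := by simp only [hb, ← mul_assoc, h3.mul_one_sub_self, zero_mul]
      have hrq : Commute (r i) (q i) := hc _ (show b i * q i = q i * b i by rw [hbq, hqb])
      -- Because `r` commutes with `q`, the product `r q` is a projection; because `b q = 0`, its
      -- norm is at most `‖r - b‖ < 1`, so it vanishes.
      have h4 : IsStarProjection (r i * q i) := by
        refine isStarProjection_of ?_ (by rw [star_mul, hpr.star_eq, h3.star_eq, hrq.eq])
        rw [mul_assoc, ← mul_assoc (q i), ← hrq.eq, mul_assoc, h3.mul_self, ← mul_assoc,
          hpr.mul_self]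
      have h5 : r i * q i = 0 := by
        refine h4.eq_zero_of_norm_lt ?_
        have : r i * q i = (r i - b i) * q i := by rw [sub_mul, hbq, sub_zero]
        rw [this]
        calc _ ≤ ‖r i - b i‖ * ‖q i‖ := norm_mul_le _ _
          _ ≤ ‖r i - b i‖ := mul_le_of_le_one_right (norm_nonneg _) h3.norm_le
          _ < 1 := by linarith
      exact ⟨hpr, h5, by rw [← hrq.eq, h5]⟩
    have hqg : ∀ i, ((∀ g ∈ s, IsStarProjection (p i g)) ∧
        ∀ g ∈ s, ∀ h ∈ s, g ≠ h → p i g * p i h = 0) → ∀ g ∈ s,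
          p i g * q i = p i g ∧ q i * p i g = p i g := by
      intro i hi g hg
      simp only [hq, Finset.mul_sum, Finset.sum_mul]
      constructor
      · rw [Finset.sum_eq_single_of_mem g hg fun j hj hjg => hi.2 g hg j hj hjg.symm,
          (hi.1 g hg).mul_self]
      · rw [Finset.sum_eq_single_of_mem g hg fun j hj hjg => hi.2 j hj g hg hjg,
          (hi.1 g hg).mul_self]
    have hne : ∀ g ∈ s, g ≠ k := fun g hg h => hk (h ▸ hg)
    refine ⟨fun i => Function.update (p i) k (r i), ?_, ?_⟩
    · filter_upwards [hp, hrp] with i hi hi'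
      constructor
      · intro g hg
        rcases Finset.mem_insert.1 hg with rfl | hg
        · simpa using hi'.1
        · simpa [hne g hg] using hi.1 g hg
      · intro g hg h hh hgh
        rcases Finset.mem_insert.1 hg with rfl | hg' <;> rcases Finset.mem_insert.1 hh with rfl | hh'
        · exact (hgh rfl).elim
        · rw [Function.update_self, Function.update_of_ne hgh.symm, ← (hqg i hi h hh').2,
            ← mul_assoc, hi'.2.1, zero_mul]
        · rw [Function.update_self, Function.update_of_ne hgh, ← (hqg i hi g hg').1,
            mul_assoc, hi'.2.2, mul_zero]
        · rw [Function.update_of_ne (hne g hg'), Function.update_of_ne (hne h hh')]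
          exact hi.2 g hg' h hh' hgh
    · intro g hg
      rcases Finset.mem_insert.1 hg with rfl | hg
      · simpa using hrb.add hba
      · simpa [hne g hg] using hpa g hg

end Perturbation

/-! ### Rokhlin properties in terms of nets -/

section Nets

variable {G A : Type*} [Group G] [CStarAlgebra A]

/-- A net of families of mutually orthogonal projections which are asymptotically permuted by the
action and asymptotically central. -/
structure IsRokhlinNet (α : G →* (A ≃⋆ₐ[ℂ] A)) {I : Type*} (l : Filter I) (e : I → G → A) :
    Prop where
  isStarProjection : ∀ᶠ i in l, ∀ g, IsStarProjection (e i g)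
  orthogonal : ∀ᶠ i in l, ∀ g h, g ≠ h → e i g * e i h = 0
  tendsto_action : ∀ g h, Tendsto (fun i => α g (e i h) - e i (g * h)) l (𝓝 0)
  tendsto_commutator : ∀ g a, Tendsto (fun i => e i g * a - a * e i g) l (𝓝 0)

variable {α : G →* (A ≃⋆ₐ[ℂ] A)}

theorem eventually_norm_lt_of_tendsto_zero {I : Type*} {l : Filter I} {u : I → A}
    (h : Tendsto u l (𝓝 0)) {ε : ℝ} (hε : 0 < ε) : ∀ᶠ i in l, ‖u i‖ < ε :=
  (tendsto_norm_zero.comp h).eventually (gt_mem_nhds hε)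

theorem isRokhlinNet_atTop {e : Finset A × ℕ → G → A}
    (h₁ : ∀ i g, IsStarProjection (e i g)) (h₂ : ∀ i g h, g ≠ h → e i g * e i h = 0)
    (h₃ : ∀ i g h, ‖α g (e i h) - e i (g * h)‖ < 1 / ((i.2 : ℝ) + 1))
    (h₄ : ∀ i g, ∀ a ∈ i.1, ‖e i g * a - a * e i g‖ < 1 / ((i.2 : ℝ) + 1)) :
    IsRokhlinNet α atTop e := by
  have hlim : Tendsto (fun i : Finset A × ℕ => 1 / ((i.2 : ℝ) + 1)) atTop (𝓝 0) := by
    refine tendsto_one_div_add_atTop_nhds_zero_nat.comp ?_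
    rw [← prod_atTop_atTop_eq]
    exact tendsto_snd
  refine ⟨.of_forall h₁, .of_forall h₂, fun g h => ?_, fun g a => ?_⟩
  · exact squeeze_zero_norm (fun i => (h₃ i g h).le) hlim
  · refine squeeze_zero_norm' ?_ hlim
    filter_upwards [eventually_ge_atTop (({a}, 0) : Finset A × ℕ)] with i hi
    exact (h₄ i g a (hi.1 (by simp))).le

variable [Fintype G]

theorem IsRokhlinNet.eventually {I : Type*} {l : Filter I} {e : I → G → A}
    (he : IsRokhlinNet α l e) (F : Finset A) {ε : ℝ} (hε : 0 < ε) :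
    ∀ᶠ i in l, (∀ g, IsStarProjection (e i g)) ∧
      (∀ g h, g ≠ h → e i g * e i h = 0) ∧
      (∀ g h, ‖α g (e i h) - e i (g * h)‖ < ε) ∧
      (∀ g, ∀ a ∈ F, ‖e i g * a - a * e i g‖ < ε) := by
  refine he.isStarProjection.and (he.orthogonal.and (Filter.Eventually.and ?_ ?_))
  · exact eventually_all.2 fun g => eventually_all.2 fun h =>
      eventually_norm_lt_of_tendsto_zero (he.tendsto_action g h) hε
  · exact eventually_all.2 fun g => (eventually_all_finset F).2 fun a _ =>
      eventually_norm_lt_of_tendsto_zero (he.tendsto_commutator g a) hε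

theorem IsRokhlinNet.sum {I : Type*} {l : Filter I} {e : I → G → A}
    (he : IsRokhlinNet α l e) : ∀ᶠ i in l, IsStarProjection (∑ g, e i g) := by
  classical
  filter_upwards [he.isStarProjection, he.orthogonal] with i h1 h2
  exact IsStarProjection.sum _ (fun g _ => h1 g) fun g _ h _ => h2 g h

theorem IsRokhlinNet.tendsto_commutator_sum {I : Type*} {l : Filter I} {e : I → G → A}
    (he : IsRokhlinNet α l e) (a : A) :
    Tendsto (fun i => (∑ g, e i g) * a - a * ∑ g, e i g) l (𝓝 0) := by
  simp only [Finset.sum_mul, Finset.mul_sum, ← Finset.sum_sub_distrib]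
  rw [← Finset.sum_const_zero (ι := G) (s := Finset.univ)]
  exact tendsto_finsetSum _ fun g _ => he.tendsto_commutator g a

theorem RokhlinProperty.exists_net (hα : RokhlinProperty α) :
    ∃ e : Finset A × ℕ → G → A, IsRokhlinNet α atTop e ∧ ∀ᶠ i in atTop, ∑ g, e i g = 1 := by
  choose e h1 h2 h3 h4 h5 using fun i : Finset A × ℕ =>
    hα i.1 (1 / ((i.2 : ℝ) + 1)) Nat.one_div_pos_of_nat
  exact ⟨e, isRokhlinNet_atTop h1 h2 h3 h4, .of_forall h5⟩

theorem IsRokhlinNet.rokhlinProperty {I : Type*} {l : Filter I} [l.NeBot] {e : I → G → A}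
    (he : IsRokhlinNet α l e) (h : ∀ᶠ i in l, ∑ g, e i g = 1) : RokhlinProperty α := by
  intro F ε hε
  obtain ⟨i, ⟨h1, h2, h3, h4⟩, h5⟩ := ((he.eventually F hε).and h).exists
  exact ⟨e i, h1, h2, h3, h4, h5⟩

variable [PartialOrder A] [StarOrderedRing A]

theorem TracialRokhlinProperty.exists_net (hα : TracialRokhlinProperty α) {x : A} (hx : 0 ≤ x)
    (hx1 : ‖x‖ = 1) :
    ∃ e : Finset A × ℕ → G → A, IsRokhlinNet α atTop e ∧
      (∀ᶠ i in atTop, ∃ v ∈ closedRightIdeal x, star v * v = 1 - ∑ g, e i g) ∧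
      ∀ ε > 0, ∀ᶠ i in atTop, 1 - ε < ‖(∑ g, e i g) * x * ∑ g, e i g‖ := by
  classical
  choose e h1 h2 h3 h4 h5 h6 using fun i : Finset A × ℕ =>
    hα i.1 (1 / ((i.2 : ℝ) + 1)) Nat.one_div_pos_of_nat x hx hx1
  refine ⟨e, isRokhlinNet_atTop h1 h2 h3 h4, .of_forall fun i => ?_, fun ε hε => ?_⟩
  · exact (exists_mem_hereditarySet_iff hx.isSelfAdjoint (IsStarProjection.sum _
      (fun g _ => h1 i g) fun g _ h _ => h2 i g h).one_sub).1 (h5 i)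
  · have hlim : Tendsto (fun i : Finset A × ℕ => 1 / ((i.2 : ℝ) + 1)) atTop (𝓝 0) := by
      refine tendsto_one_div_add_atTop_nhds_zero_nat.comp ?_
      rw [← prod_atTop_atTop_eq]
      exact tendsto_snd
    filter_upwards [hlim.eventually (gt_mem_nhds hε)] with i hi
    linarith [h6 i]

/-- The net may depend on `ε`: in the ascent to matrices the spectral cutdown of `x` is chosen after
`ε`. -/
theorem tracialRokhlinProperty_of_net
    (h : ∀ x : A, 0 ≤ x → ‖x‖ = 1 → ∀ ε > 0, ∃ (I : Type*) (l : Filter I) (_ : l.NeBot)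
      (e : I → G → A), IsRokhlinNet α l e ∧
      (∀ᶠ i in l, ∃ v ∈ closedRightIdeal x, star v * v = 1 - ∑ g, e i g) ∧
      ∀ᶠ i in l, 1 - ε < ‖(∑ g, e i g) * x * ∑ g, e i g‖) : TracialRokhlinProperty α := by
  classical
  intro F ε hε x hx hx1
  obtain ⟨I, l, _, e, he, h5, h6⟩ := h x hx hx1 ε hε
  obtain ⟨i, ⟨⟨h1, h2, h3, h4⟩, h5⟩, h6⟩ := (((he.eventually F hε).and h5).and h6).exists
  refine ⟨e i, h1, h2, h3, h4, ?_, h6⟩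
  exact (exists_mem_hereditarySet_iff hx.isSelfAdjoint (IsStarProjection.sum _
      (fun g _ => h1 g) fun g _ h _ => h2 g h).one_sub).2 h5

theorem RokhlinProperty.tracialRokhlinProperty (hα : RokhlinProperty α) :
    TracialRokhlinProperty α := by
  intro F ε hε x _ hx1
  obtain ⟨e, h1, h2, h3, h4, h5⟩ := hα F ε hε
  refine ⟨e, h1, h2, h3, h4, ⟨0, subset_closure ⟨0, by simp⟩, .zero _, 0, ?_, ?_⟩, ?_⟩
  · simp [h5]
  · simp
  · simp [h5, hx1, hε]

end Nets

/-! ### Consequences of simplicity -/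

section Simple

variable {A : Type*} [CStarAlgebra A]

/-- Otherwise the closed two-sided ideal of all `y` with `b A y A = 0` contains `c`, hence also `1`,
which forces `b = 0`. -/
theorem IsSimpleCStarAlgebra.exists_mul_mul_ne_zero (hA : IsSimpleCStarAlgebra A) {b c : A}
    (hb : b ≠ 0) (hc : c ≠ 0) : ∃ a, b * a * c ≠ 0 := by
  by_contra! h
  let J : TwoSidedIdeal A := .mk' {y | ∀ a d, b * a * y * d = 0} (by simp)
    (fun {x y} hx hy a d => by rw [mul_add, add_mul, hx, hy, add_zero])
    (fun {x} hx a d => by rw [mul_neg, neg_mul, hx, neg_zero])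
    (fun {x y} hy a d => by rw [← mul_assoc, mul_assoc b]; exact hy _ _)
    (fun {x y} hx a d => by rw [← mul_assoc, mul_assoc]; exact hx _ _)
  have hJ : ∀ y, y ∈ J ↔ ∀ a d, b * a * y * d = 0 := fun y => by
    simp only [J, TwoSidedIdeal.mem_mk', Set.mem_ofPred_eq]
  have hcl : IsClosed (J : Set A) := by
    have : (J : Set A) = ⋂ a, ⋂ d, {y | b * a * y * d = 0} := by
      ext y; simp [hJ]
    rw [this]
    exact isClosed_iInter fun a => isClosed_iInter fun d =>
      isClosed_eq (by fun_prop) continuous_const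
  rcases hA.2 J hcl with h1 | h1
  · have : c ∈ J := (hJ c).2 fun a d => by rw [h, zero_mul]
    rw [h1, TwoSidedIdeal.mem_bot] at this
    exact hc this
  · have : (1 : A) ∈ J := by rw [h1]; trivial
    exact hb (by simpa using (hJ 1).1 this 1 1)

/-- If a net of contractions is asymptotically central and asymptotically acts as a scalar on a
nonzero element of a simple C⋆-algebra, then it is asymptotically scalar. -/
theorem IsSimpleCStarAlgebra.tendsto_sub_smul_one (hA : IsSimpleCStarAlgebra A) {I : Type*}
    {l : Filter I} {E : I → A} {t : I → ℝ} {q : A} (hq : q ≠ 0) (hE : ∀ᶠ i in l, ‖E i‖ ≤ 1)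
    (ht : ∀ᶠ i in l, |t i| ≤ 1)
    (hcomm : ∀ a, Tendsto (fun i => E i * a - a * E i) l (𝓝 0))
    (hEq : Tendsto (fun i => E i * q - t i • q) l (𝓝 0)) :
    Tendsto (fun i => E i - t i • (1 : A)) l (𝓝 0) := by
  -- The elements on which the net is asymptotically scalar form an ideal: asymptotic centrality
  -- handles left multiplication, and the uniform bounds on `E` and `t` make it closed.
  let J : TwoSidedIdeal A := .mk' {y | Tendsto (fun i => E i * y - t i • y) l (𝓝 0)}
    (by simpa using tendsto_const_nhds)
    (fun {x y} hx hy => by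
      have h := Tendsto.add hx hy
      rw [add_zero] at h
      exact h.congr fun i => by rw [mul_add, smul_add]; abel)
    (fun {x} hx => by
      have h := Tendsto.neg hx
      rw [neg_zero] at h
      exact h.congr fun i => by rw [mul_neg, smul_neg]; abel)
    (fun {x y} hy => by
      have h := ((hcomm x).mul_const y).add (Tendsto.const_mul x hy)
      rw [zero_mul, mul_zero, add_zero] at h
      exact h.congr fun i => by
        rw [sub_mul, mul_sub, mul_smul_comm]; noncomm_ring)
    (fun {x y} hx => by
      have h := Tendsto.mul_const y hx
      rw [zero_mul] at h
      exact h.congr fun i => by rw [sub_mul, smul_mul_assoc, mul_assoc])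
  have hJ : ∀ y, y ∈ J ↔ Tendsto (fun i => E i * y - t i • y) l (𝓝 0) := fun y => by
    simp only [J, TwoSidedIdeal.mem_mk', Set.mem_ofPred_eq]
  have hcl : IsClosed (J : Set A) := by
    refine isClosed_of_closure_subset fun y hy => ?_
    rw [SetLike.mem_coe, hJ, Metric.tendsto_nhds]
    intro ε hε
    obtain ⟨z, hz, hyz⟩ := Metric.mem_closure_iff.1 hy (ε / 4) (by positivity)
    rw [SetLike.mem_coe, hJ, Metric.tendsto_nhds] at hz
    filter_upwards [hz (ε / 2) (by positivity), hE, ht] with i h1 h2 h3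
    rw [dist_zero_right] at h1 ⊢
    rw [dist_eq_norm] at hyz
    have e1 : E i * y - t i • y = E i * (y - z) - t i • (y - z) + (E i * z - t i • z) := by
      rw [mul_sub, smul_sub]; abel
    have e2 : ‖E i * (y - z)‖ ≤ ‖y - z‖ :=
      (norm_mul_le _ _).trans (mul_le_of_le_one_left (norm_nonneg _) h2)
    have e3 : ‖t i • (y - z)‖ ≤ ‖y - z‖ := by
      rw [norm_smul, Real.norm_eq_abs]
      exact mul_le_of_le_one_left (norm_nonneg _) h3
    rw [e1]
    calc _ ≤ ‖E i * (y - z) - t i • (y - z)‖ + ‖E i * z - t i • z‖ := norm_add_le _ _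
      _ ≤ ‖E i * (y - z)‖ + ‖t i • (y - z)‖ + ‖E i * z - t i • z‖ := by
        gcongr; exact norm_sub_le _ _
      _ < ε := by linarith
  rcases hA.2 J hcl with h1 | h1
  · have : q ∈ J := (hJ q).2 hEq
    rw [h1, TwoSidedIdeal.mem_bot] at this
    exact (hq this).elim
  · have : (1 : A) ∈ J := by rw [h1]; trivial
    simpa using (hJ 1).1 this

/-- If both `p` and `1 - p` are nonzero, multiplying `p - t` by each shows that its norm dominates
`|1 - t|` and `|t|`, so it is at least `1/2`. -/
theorem IsStarProjection.eq_one_of_norm_sub_smul_lt {p : A} (hp : IsStarProjection p) (h0 : p ≠ 0)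
    {t : ℝ} (ht : ‖p - t • (1 : A)‖ < 1 / 4) : p = 1 := by
  by_contra h1
  have h2 : ‖1 - p‖ = 1 := hp.one_sub.norm_eq_one (sub_ne_zero.2 (Ne.symm h1))
  have h3 : ‖p‖ = 1 := hp.norm_eq_one h0
  have e1 : (p - t • (1 : A)) * p = (1 - t) • p := by
    rw [sub_mul, hp.mul_self, smul_mul_assoc, one_mul, sub_smul, one_smul]
  have e2 : (p - t • (1 : A)) * (1 - p) = (-t) • (1 - p) := by
    rw [sub_mul, hp.mul_one_sub_self, smul_mul_assoc, one_mul, neg_smul, zero_sub]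
  have e3 : |1 - t| ≤ ‖p - t • (1 : A)‖ := by
    have := norm_mul_le (p - t • (1 : A)) p
    rwa [e1, norm_smul, h3, mul_one, mul_one, Real.norm_eq_abs] at this
  have e4 : |-t| ≤ ‖p - t • (1 : A)‖ := by
    have := norm_mul_le (p - t • (1 : A)) (1 - p)
    rwa [e2, norm_smul, h2, mul_one, mul_one, Real.norm_eq_abs] at this
  linarith [le_abs_self (1 - t), neg_abs_le (-t)]

end Simple

/-! ### Property (SP) and absence of minimal projections -/

section PropertySP

/-- Property (SP): every nonzero hereditary subalgebra contains a nonzero projection. -/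
def PropertySP (A : Type*) [CStarAlgebra A] [PartialOrder A] : Prop :=
  ∀ a : A, 0 ≤ a → a ≠ 0 → ∃ r ∈ closedRightIdeal a, IsStarProjection r ∧ r ≠ 0

variable {A : Type*} [CStarAlgebra A] [PartialOrder A] [StarOrderedRing A]

/-- If `y = c - t q` were nonzero for a nonzero spectral value `t` of `c`, (SP) would give a nonzero
projection in the right ideal of `y²`. By minimality it is `q`, so `y` is invertible in the corner
of `q` and `c - t` is invertible in `A`. -/
theorem PropertySP.exists_smul_eq_of_minimal (hA : PropertySP A) {q : A} (hq : IsStarProjection q)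
    (hmin : ∀ r, IsStarProjection r → r ≠ 0 → q * r = r → r = q) {c : A} (hc : IsSelfAdjoint c)
    (hqc : q * c = c) : ∃ t : ℝ, c = t • q := by
  by_cases hc0 : c = 0
  · exact ⟨0, by simp [hc0]⟩
  have : Nontrivial A := ⟨⟨c, 0, hc0⟩⟩
  have hcq : c * q = c := by
    have := congrArg star hqc
    rwa [star_mul, hc.star_eq, hq.star_eq] at this
  -- Nonzero `t` is needed because `c - t` acts on `1 - q` as `-t`.
  obtain ⟨t, ht0, ht⟩ : ∃ t : ℝ, t ≠ 0 ∧ t ∈ spectrum ℝ c := by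
    have hn := norm_ne_zero_iff.2 hc0
    rcases CStarAlgebra.norm_or_neg_norm_mem_spectrum (a := c) hc with h | h
    · exact ⟨_, hn, h⟩
    · exact ⟨_, neg_ne_zero.2 hn, h⟩
  refine ⟨t, ?_⟩
  by_contra hne
  set y := c - t • q with hy
  have hy0 : y ≠ 0 := sub_ne_zero.2 hne
  have hysa : star y = y := by
    rw [hy, star_sub, hc.star_eq, star_smul, hq.star_eq, star_trivial]
  have hqy : q * y = y := by rw [hy, mul_sub, hqc, mul_smul_comm, hq.mul_self]
  have hyy : 0 ≤ y * y := by
    have := star_mul_self_nonneg y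
    rwa [hysa] at this
  have hyy0 : y * y ≠ 0 := by
    have := (CStarRing.star_mul_self_ne_zero_iff y).2 hy0
    rwa [hysa] at this
  obtain ⟨r, hr, hrp, hr0⟩ := hA _ hyy hyy0
  have hrq : r = q := hmin r hrp hr0
    (mul_eq_self_of_mem_closedRightIdeal (by rw [← mul_assoc, hqy]) hr)
  obtain ⟨m, hm⟩ := exists_norm_mul_sub_lt_one hr
  rw [hrq] at hm
  set s := c - algebraMap ℝ A t with hs
  -- An approximate right inverse of `s`, assembled from the two corners. A right inverse suffices
  -- since `s` is self-adjoint.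
  set w := q * (y * m * q) - t⁻¹ • (1 - q) with hw
  have hsq : s * q = y := by
    rw [hs, sub_mul, hcq, Algebra.algebraMap_eq_smul_one, smul_mul_assoc, one_mul]
  have hsw : s * w = y * y * m * q + (1 - q) := by
    rw [hw, mul_sub, ← mul_assoc s, hsq, mul_smul_comm, mul_sub, mul_one, hsq, hs, hy,
      Algebra.algebraMap_eq_smul_one]
    have : t⁻¹ • (c - t • (1 : A) - (c - t • q)) = -(1 - q) := by
      rw [sub_sub_sub_cancel_left, ← smul_sub, smul_smul, inv_mul_cancel₀ ht0, one_smul]; abel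
    rw [this]
    noncomm_ring
  have hu : IsUnit (s * w) := by
    refine isUnit_of_norm_sub_one_lt ?_
    have : s * w - 1 = (y * y * m - q) * q := by
      rw [hsw, sub_mul _ q q, hq.mul_self]; abel
    rw [this]
    exact (norm_mul_le _ _).trans_lt
      ((mul_le_of_le_one_right (norm_nonneg _) hq.norm_le).trans_lt hm)
  obtain ⟨u, hu⟩ := hu
  have hr1 : s * (w * ↑u⁻¹) = 1 := by rw [← mul_assoc, ← hu, Units.mul_inv]
  have hssa : star s = s := by
    rw [hs, star_sub, hc.star_eq, ← algebraMap_star_comm, star_trivial]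
  have hl1 : star (w * ↑u⁻¹) * s = 1 := by
    have := congrArg star hr1
    rwa [star_mul, hssa, star_one] at this
  have hsu : IsUnit s := isUnit_iff_exists_and_exists.2 ⟨⟨_, hr1⟩, ⟨_, hl1⟩⟩
  rw [spectrum.mem_iff] at ht
  exact ht (by rw [← neg_sub]; exact hsu.neg)

/-- Split `q` as `r + (q - r)` and choose `z = r a (q - r) ≠ 0`. Property (SP) for `z⋆z` gives `p`
under `q - r`, and the polar decomposition of `z p` moves it under `r`. -/
theorem PropertySP.exists_orthogonal_equivalent (hA : PropertySP A) (hs : IsSimpleCStarAlgebra A)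
    (hsub : ∀ q : A, IsStarProjection q → q ≠ 0 →
      ∃ r, IsStarProjection r ∧ r ≠ 0 ∧ q * r = r ∧ r ≠ q)
    {q : A} (hq : IsStarProjection q) (hq0 : q ≠ 0) :
    ∃ p v, IsStarProjection p ∧ p ≠ 0 ∧ q * p = p ∧ star v * v = p ∧ q * v = v ∧
      star v * p = 0 := by
  obtain ⟨r, hr, hr0, hqr, hrq⟩ := hsub q hq hq0
  have hrq' : r * q = r := by
    have := congrArg star hqr
    rwa [star_mul, hr.star_eq, hq.star_eq] at this
  obtain ⟨a, ha⟩ := hs.exists_mul_mul_ne_zero hr0 (sub_ne_zero.2 hrq.symm)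
  set z := r * a * (q - r) with hz
  have hrz : r * z = z := by simp only [hz, ← mul_assoc, hr.mul_self]
  have hqz : (q - r) * (star z * z) = star z * z := by
    have : (q - r) * star z = star z := by
      have h1 : (q - r) * (q - r) = q - r := by
        rw [sub_mul, mul_sub, mul_sub, hq.mul_self, hqr, hrq', hr.mul_self]; abel
      simp only [hz, star_mul, star_sub, hq.star_eq, hr.star_eq, ← mul_assoc, h1]
    rw [← mul_assoc, this]
  obtain ⟨p, hpz, hp, hp0⟩ := hA _ (star_mul_self_nonneg z)
    ((CStarRing.star_mul_self_ne_zero_iff z).2 ha)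
  have hqp : (q - r) * p = p := mul_eq_self_of_mem_closedRightIdeal hqz hpz
  obtain ⟨m, hm⟩ := exists_norm_mul_sub_lt_one hpz
  obtain ⟨c, hc⟩ := exists_star_mul_self_eq (b := z) (m := star m * star z) hp (by
    have : star m * star z * z * p - p = star (star z * z * m - p) * p := by
      simp only [star_sub, star_mul, star_star, sub_mul, hp.star_eq, hp.mul_self, mul_assoc]
    rw [this]
    refine (norm_mul_le _ _).trans_lt ?_
    rw [norm_star]
    exact (mul_le_of_le_one_right (norm_nonneg _) hp.norm_le).trans_lt hm)
  have hrv : r * (z * p * c) = z * p * c := by simp only [← mul_assoc, hrz]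
  refine ⟨p, z * p * c, hp, hp0, ?_, hc, ?_, ?_⟩
  · rw [← hqp, ← mul_assoc, mul_sub, hq.mul_self, hqr]
  · rw [← hrv, ← mul_assoc, hqr]
  · rw [← hrv, ← hqp, star_mul, hr.star_eq, mul_assoc, ← mul_assoc r, mul_sub, hrq', hr.mul_self]
    simp

theorem PropertySP.exists_orthogonal_family (hA : PropertySP A) (hs : IsSimpleCStarAlgebra A)
    (hsub : ∀ q : A, IsStarProjection q → q ≠ 0 →
      ∃ r, IsStarProjection r ∧ r ≠ 0 ∧ q * r = r ∧ r ≠ q) (n : ℕ)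
    {q : A} (hq : IsStarProjection q) (hq0 : q ≠ 0) :
    ∃ (p : A) (v : Fin (n + 1) → A), IsStarProjection p ∧ p ≠ 0 ∧ (∀ i, q * v i = v i) ∧
      ∀ i j, star (v i) * v j = if i = j then p else 0 := by
  induction n generalizing q with
  | zero =>
    exact ⟨q, fun _ => q, hq, hq0, fun _ => hq.mul_self, fun i j => by
      rw [if_pos (Fin.subsingleton_one.elim i j), hq.star_eq, hq.mul_self]⟩
  | succ n ih =>
    obtain ⟨p, s, hp, hp0, hqp, hsp, hqs, hsp0⟩ := hA.exists_orthogonal_equivalent hs hsub hq hq0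
    obtain ⟨p', v, hp', hp0', hpv, hv⟩ := ih hp hp0
    have hsv : ∀ j, star s * v j = 0 := fun j => by rw [← hpv j, ← mul_assoc, hsp0, zero_mul]
    have hvs : ∀ j, star (v j) * s = 0 := fun j => by
      have := congrArg star (hsv j)
      rwa [star_mul, star_star, star_zero] at this
    -- The family inside `p` gains one member: a copy of `v 0` carried by `s` to a place orthogonal
    -- to `p`.
    refine ⟨p', Fin.cons (s * v 0) v, hp', hp0', fun i => ?_, fun i j => ?_⟩
    · refine Fin.cases ?_ (fun i => ?_) i
      · rw [Fin.cons_zero, ← mul_assoc, hqs]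
      · rw [Fin.cons_succ, ← hpv i, ← mul_assoc, hqp]
    · refine Fin.cases ?_ (fun i => ?_) i <;> refine Fin.cases ?_ (fun j => ?_) j
      · rw [Fin.cons_zero, star_mul, mul_assoc, ← mul_assoc (star s), hsp, hpv, hv,
          if_pos rfl, if_pos rfl]
      · rw [Fin.cons_zero, Fin.cons_succ, star_mul, mul_assoc, hsv, mul_zero,
          if_neg (Fin.succ_ne_zero j).symm]
      · rw [Fin.cons_zero, Fin.cons_succ, ← mul_assoc, hvs, zero_mul,
          if_neg (Fin.succ_ne_zero i)]
      · rw [Fin.cons_succ, Fin.cons_succ, hv]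
        simp only [Fin.succ_inj]

variable {G : Type*} [Group G] [Fintype G] {α : G →* (A ≃⋆ₐ[ℂ] A)}

/-- For `F` and `ε` witnessing the failure of the Rokhlin property, the remainder `1 - e` is never
zero, so its copy under any given positive element is a nonzero projection. -/
theorem TracialRokhlinProperty.propertySP (hα : TracialRokhlinProperty α)
    (hα' : ¬ RokhlinProperty α) : PropertySP A := by
  intro a ha ha0
  unfold RokhlinProperty at hα'
  push Not at hα'
  obtain ⟨F, ε, hε, hF⟩ := hα'
  have hn := norm_ne_zero_iff.2 ha0
  obtain ⟨e, h1, h2, h3, h4, ⟨q, hqx, hq, v, hv, hvq⟩, -⟩ := hα F ε hε (‖a‖⁻¹ • a)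
    (smul_nonneg (by positivity) ha) (by rw [norm_smul, norm_inv, norm_norm, inv_mul_cancel₀ hn])
  refine ⟨q, ?_, hq, ?_⟩
  · refine closure_mono ?_ hqx
    rintro _ ⟨b, rfl⟩
    exact ⟨‖a‖⁻¹ • (b * (‖a‖⁻¹ • a)), by simp [mul_assoc]⟩
  · rintro rfl
    rw [CStarRing.mul_star_self_eq_zero_iff] at hvq
    rw [hvq, mul_zero] at hv
    exact hF e h1 h2 h3 h4 (sub_eq_zero.1 hv.symm).symm

/-- For minimal `q` one has `q E q = t q`, so asymptotic centrality gives `E q ≈ t q` and simplicity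
gives `E ≈ t`. The norm condition with `x = q` excludes `E = 0`; hence eventually `E = 1`, which is
the Rokhlin property. -/
theorem TracialRokhlinProperty.exists_proper_subprojection (hA : IsSimpleCStarAlgebra A)
    (hα : TracialRokhlinProperty α) (hα' : ¬ RokhlinProperty α) {q : A} (hq : IsStarProjection q)
    (hq0 : q ≠ 0) : ∃ r, IsStarProjection r ∧ r ≠ 0 ∧ q * r = r ∧ r ≠ q := by
  classical
  by_contra! hmin
  have hq1 := hq.norm_eq_one hq0
  obtain ⟨e, he, -, hnorm⟩ := hα.exists_net hq.nonneg hq1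
  set E := fun i => ∑ g, e i g with hE
  have hex : ∀ i, ∃ t : ℝ, IsStarProjection (E i) → q * E i * q = t • q := by
    intro i
    by_cases h : IsStarProjection (E i)
    · obtain ⟨t, ht⟩ := (hα.propertySP hα').exists_smul_eq_of_minimal hq hmin
        (c := q * E i * q) (by simp [isSelfAdjoint_iff, hq.star_eq, h.star_eq, mul_assoc])
        (by simp only [← mul_assoc, hq.mul_self])
      exact ⟨t, fun _ => ht⟩
    · exact ⟨0, fun h' => (h h').elim⟩
  choose t ht using hex
  have hE1 : ∀ᶠ i in atTop, ‖E i‖ ≤ 1 := he.sum.mono fun i hi => hi.norm_le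
  have ht1 : ∀ᶠ i in atTop, |t i| ≤ 1 := by
    filter_upwards [he.sum] with i hi
    have h1 : ‖t i • q‖ ≤ 1 := by
      rw [← ht i hi]
      calc _ ≤ ‖q‖ * ‖E i‖ * ‖q‖ := norm_mul₃_le
        _ ≤ 1 := by rw [hq1, one_mul, mul_one]; exact hi.norm_le
    rwa [norm_smul, hq1, mul_one, Real.norm_eq_abs] at h1
  have hEq : Tendsto (fun i => E i * q - t i • q) atTop (𝓝 0) := by
    have h1 := (he.tendsto_commutator_sum q).mul_const q
    rw [zero_mul] at h1
    refine h1.congr' ?_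
    filter_upwards [he.sum] with i hi
    rw [← ht i hi, sub_mul, mul_assoc _ q q, hq.mul_self]
  have hlim := hA.tendsto_sub_smul_one hq0 hE1 ht1 he.tendsto_commutator_sum hEq
  refine hα' (he.rokhlinProperty ?_)
  filter_upwards [he.sum, eventually_norm_lt_of_tendsto_zero hlim (by norm_num : (0 : ℝ) < 1 / 4),
    hnorm 1 one_pos] with i h1 h2 h3
  refine h1.eq_one_of_norm_sub_smul_lt ?_ h2
  intro h0
  rw [h0] at h3
  simp at h3

end PropertySP

/-! ### Elementary tensors in matrices over `A` -/

section ElemTensor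

variable {A : Type*} [CStarAlgebra A] {n : Type*}

theorem elemTensor_apply (a : A) (b : Matrix n n ℂ) (i j : n) :
    elemTensor a b i j = b i j • a := rfl

theorem star_elemTensor (a : A) (b : Matrix n n ℂ) :
    star (elemTensor a b) = elemTensor (star a) (star b) := by
  ext i j
  simp [CStarMatrix.star_apply, elemTensor_apply, Matrix.star_apply]

theorem elemTensor_sub (a c : A) (b : Matrix n n ℂ) :
    elemTensor (a - c) b = elemTensor a b - elemTensor c b := by
  ext i j
  simp [elemTensor_apply, smul_sub]

theorem elemTensor_add (a c : A) (b : Matrix n n ℂ) :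
    elemTensor (a + c) b = elemTensor a b + elemTensor c b := by
  ext i j
  simp [elemTensor_apply]

theorem zero_elemTensor (b : Matrix n n ℂ) : elemTensor (0 : A) b = 0 := by
  ext i j
  simp [elemTensor_apply]

theorem elemTensor_smul (t : ℂ) (a : A) (b : Matrix n n ℂ) :
    elemTensor (t • a) b = t • elemTensor a b := by
  ext i j
  simp [elemTensor_apply, smul_comm t]

theorem elemTensor_sum {ι : Type*} (s : Finset ι) (a : ι → A) (b : Matrix n n ℂ) :
    elemTensor (∑ g ∈ s, a g) b = ∑ g ∈ s, elemTensor (a g) b := by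
  classical
  induction s using Finset.induction_on with
  | empty => exact zero_elemTensor b
  | insert k s hk ih => rw [Finset.sum_insert hk, Finset.sum_insert hk, elemTensor_add, ih]

variable [Fintype n]

theorem elemTensor_mul (a c : A) (b d : Matrix n n ℂ) :
    elemTensor a b * elemTensor c d = elemTensor (a * c) (b * d) := by
  ext i j
  simp only [CStarMatrix.mul_apply, elemTensor_apply, Matrix.mul_apply, Finset.sum_smul]
  exact Finset.sum_congr rfl fun k _ => by rw [smul_mul_smul_comm]

variable [DecidableEq n]

omit [Fintype n] in
theorem elemTensor_one_one : elemTensor (1 : A) (1 : Matrix n n ℂ) = 1 := by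
  ext i j
  by_cases h : i = j <;> simp [elemTensor_apply, CStarMatrix.one_apply, h]

theorem sum_elemTensor_single (a : A) :
    ∑ i : n, elemTensor a (Matrix.single i i 1) = elemTensor a 1 := by
  have : ∀ s : Finset n, ∑ i ∈ s, elemTensor a (Matrix.single i i 1) =
      elemTensor a (∑ i ∈ s, Matrix.single i i 1) := by
    intro s
    induction s using Finset.induction_on with
    | empty => ext i j; simp [elemTensor_apply]
    | insert k s hk ih =>
      rw [Finset.sum_insert hk, Finset.sum_insert hk, ih]
      ext i j
      simp [elemTensor_apply, add_smul]
  rw [this, Matrix.sum_single_one]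

theorem elemTensor_one_mul_apply (a : A) (X : CStarMatrix n n A) (i j : n) :
    (elemTensor a 1 * X : CStarMatrix n n A) i j = a * X i j := by
  rw [CStarMatrix.mul_apply, Finset.sum_eq_single i]
  · simp [elemTensor_apply]
  · intro k _ hk
    simp [elemTensor_apply, Matrix.one_apply_ne hk.symm]
  · simp

theorem mul_elemTensor_one_apply (a : A) (X : CStarMatrix n n A) (i j : n) :
    (X * elemTensor a 1 : CStarMatrix n n A) i j = X i j * a := by
  rw [CStarMatrix.mul_apply, Finset.sum_eq_single j]
  · simp [elemTensor_apply]
  · intro k _ hk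
    simp [elemTensor_apply, Matrix.one_apply_ne hk]
  · simp

theorem elemTensor_single_mul_apply (a : A) (X : CStarMatrix n n A) (r c i j : n) :
    (elemTensor a (Matrix.single r c 1) * X) i j = if r = i then a * X c j else 0 := by
  rw [CStarMatrix.mul_apply, Finset.sum_eq_single c]
  · by_cases h : r = i <;> simp [elemTensor_apply, h]
  · intro k _ hk
    simp [elemTensor_apply, hk.symm]
  · simp

theorem mul_elemTensor_single_apply (a : A) (X : CStarMatrix n n A) (r c i j : n) :
    (X * elemTensor a (Matrix.single r c 1)) i j = if c = j then X i r * a else 0 := by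
  rw [CStarMatrix.mul_apply, Finset.sum_eq_single r]
  · by_cases h : c = j <;> simp [elemTensor_apply, h]
  · intro k _ hk
    simp [elemTensor_apply, hk.symm]
  · simp

theorem single_mul_mul_single (X : CStarMatrix n n A) (k : n) :
    elemTensor 1 (Matrix.single k k 1) * X * elemTensor 1 (Matrix.single k k 1) =
      elemTensor (X k k) (Matrix.single k k 1) := by
  ext i j
  rw [mul_elemTensor_single_apply, elemTensor_single_mul_apply, elemTensor_apply,
    Matrix.single_apply]
  by_cases hi : k = i <;> by_cases hj : k = j <;> simp [hi, hj]

theorem isStarProjection_single (k : n) : IsStarProjection (Matrix.single k k (1 : ℂ)) :=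
  ⟨by simp [IsIdempotentElem], by simp [isSelfAdjoint_iff, Matrix.star_eq_conjTranspose]⟩

omit [DecidableEq n] in
theorem IsStarProjection.elemTensor {p : A} (hp : IsStarProjection p) {b : Matrix n n ℂ}
    (hb : IsStarProjection b) : IsStarProjection (elemTensor p b) :=
  ⟨by rw [IsIdempotentElem, elemTensor_mul, hp.isIdempotentElem.eq, hb.isIdempotentElem.eq],
    by rw [isSelfAdjoint_iff, star_elemTensor, hp.isSelfAdjoint.star_eq, hb.isSelfAdjoint.star_eq]⟩

/-- Tensoring with a projection in the matrix algebra, as a ⋆-homomorphism. -/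
def elemTensorHom (A : Type*) [CStarAlgebra A] {b : Matrix n n ℂ} (hb : IsStarProjection b) :
    A →⋆ₙₐ[ℂ] CStarMatrix n n A where
  toFun a := elemTensor a b
  map_smul' t a := elemTensor_smul t a b
  map_zero' := zero_elemTensor b
  map_add' a c := elemTensor_add a c b
  map_mul' a c := by rw [elemTensor_mul, hb.isIdempotentElem.eq]
  map_star' a := by rw [star_elemTensor, hb.isSelfAdjoint.star_eq]

omit [Fintype n] [DecidableEq n] in
theorem tendsto_cstarMatrix_zero_iff [PartialOrder A] [StarOrderedRing A] {I : Type*}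
    {l : Filter I} {X : I → CStarMatrix n n A} :
    Tendsto X l (𝓝 0) ↔ ∀ r c, Tendsto (fun i => X i r c) l (𝓝 0) := by
  have h1 : Tendsto X l (𝓝 0) ↔ ∀ r, Tendsto (fun i => X i r) l (𝓝 (0 : n → A)) :=
    tendsto_pi_nhds (f := fun i r => X i r) (g := fun _ => (0 : n → A))
  rw [h1]
  exact forall_congr' fun r => tendsto_pi_nhds (f := fun i c => X i r c) (g := fun _ => (0 : A))

omit [Fintype n] [DecidableEq n] in
theorem continuous_cstarMatrix_apply [PartialOrder A] [StarOrderedRing A] (r c : n) :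
    Continuous fun X : CStarMatrix n n A => X r c :=
  (continuous_apply (A := fun _ : n => A) c).comp (continuous_apply (A := fun _ : n => n → A) r)

omit [DecidableEq n] in
theorem norm_elemTensor [PartialOrder A] [StarOrderedRing A] (a : A) {b : Matrix n n ℂ}
    (hb : IsStarProjection b) (hb0 : b ≠ 0) : ‖elemTensor a b‖ = ‖a‖ := by
  refine NonUnitalStarAlgHom.norm_map (elemTensorHom A hb) ?_ a
  refine (injective_iff_map_eq_zero _).2 fun a ha => ?_
  obtain ⟨i, j, hij⟩ : ∃ i j, b i j ≠ 0 := by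
    by_contra! h
    exact hb0 (by ext i j; exact h i j)
  have h1 : b i j • a = 0 := congrFun (congrFun ha i) j
  exact (smul_eq_zero.1 h1).resolve_left hij

theorem norm_elemTensor_one [PartialOrder A] [StarOrderedRing A] [Nonempty n] (a : A) :
    ‖elemTensor a (1 : Matrix n n ℂ)‖ = ‖a‖ :=
  norm_elemTensor a (.one _) one_ne_zero

theorem norm_elemTensor_single [PartialOrder A] [StarOrderedRing A] (a : A) (k : n) :
    ‖elemTensor a (Matrix.single k k (1 : ℂ))‖ = ‖a‖ := by
  refine norm_elemTensor a (isStarProjection_single k) fun h => ?_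
  have := congrFun (congrFun h k) k
  simp at this

theorem tendsto_of_elemTensor_one [PartialOrder A] [StarOrderedRing A] [Nonempty n] {I : Type*}
    {l : Filter I} {u : I → A} (h : Tendsto (fun i => elemTensor (u i) (1 : Matrix n n ℂ)) l (𝓝 0)) :
    Tendsto u l (𝓝 0) := by
  rw [tendsto_zero_iff_norm_tendsto_zero] at h ⊢
  simpa only [norm_elemTensor_one] using h

omit [Fintype n] in
theorem tendsto_elemTensor_one [PartialOrder A] [StarOrderedRing A] {I : Type*}
    {l : Filter I} {u : I → A} (h : Tendsto u l (𝓝 0)) :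
    Tendsto (fun i => elemTensor (u i) (1 : Matrix n n ℂ)) l (𝓝 0) := by
  rw [tendsto_cstarMatrix_zero_iff]
  intro r c
  simpa [elemTensor_apply] using h.const_smul ((1 : Matrix n n ℂ) r c)

end ElemTensor

/-! ### Rokhlin nets of the tensor product action -/

section Action

variable {G A : Type*} [Group G] [CStarAlgebra A] [PartialOrder A] [StarOrderedRing A]
  {n : Type*} [Fintype n] [DecidableEq n]
  {α : G →* (A ≃⋆ₐ[ℂ] A)} {β : G →* (Matrix n n ℂ ≃⋆ₐ[ℂ] Matrix n n ℂ)}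
  {I : Type*} {l : Filter I}

omit [PartialOrder A] [StarOrderedRing A] in
-- This is the only information about `β` that the proof needs, which is why `β` is arbitrary.
theorem tensorAction_elemTensor_one (g : G) (a : A) :
    tensorAction α β g (elemTensor a 1) = elemTensor (α g a) 1 := by
  rw [tensorAction_elemTensor, map_one]

theorem IsRokhlinNet.elemTensor_one {e : I → G → A} (he : IsRokhlinNet α l e) :
    IsRokhlinNet (tensorAction α β) l fun i g => elemTensor (e i g) 1 where
  isStarProjection := he.isStarProjection.mono fun i hi g => (hi g).elemTensor (.one _)
  orthogonal := he.orthogonal.mono fun i hi g h hgh => by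
    rw [elemTensor_mul, hi g h hgh, zero_elemTensor]
  tendsto_action g h := by
    simp only [tensorAction_elemTensor_one, ← elemTensor_sub]
    exact tendsto_elemTensor_one (he.tendsto_action g h)
  tendsto_commutator g X := by
    rw [tendsto_cstarMatrix_zero_iff]
    intro r c
    simp only [CStarMatrix.sub_apply, elemTensor_one_mul_apply, mul_elemTensor_one_apply]
    exact he.tendsto_commutator g (X r c)

variable [Fintype G]

/-- The `(r,k)` entry of the commutator with the matrix unit `e_ck` is `E_rc - δ_rc E_kk`. -/
theorem tendsto_elemTensor_apply_sub {E : I → CStarMatrix n n A}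
    (hE : ∀ X, Tendsto (fun i => E i * X - X * E i) l (𝓝 0)) (k : n) :
    Tendsto (fun i => elemTensor (E i k k) 1 - E i) l (𝓝 0) := by
  rw [tendsto_cstarMatrix_zero_iff]
  intro r c
  have h := (tendsto_cstarMatrix_zero_iff.1 (hE (elemTensor 1 (Matrix.single c k 1))) r k).neg
  rw [neg_zero] at h
  refine h.congr fun i => ?_
  rw [CStarMatrix.sub_apply, CStarMatrix.sub_apply, mul_elemTensor_single_apply,
    elemTensor_single_mul_apply, elemTensor_apply, Matrix.one_apply]
  by_cases hrc : r = c <;> simp [hrc, eq_comm]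

/-- A Rokhlin net for `α ⊗ β` is close to the amplification of a Rokhlin net for `α`. -/
theorem IsRokhlinNet.exists_elemTensor_one [Nonempty n] {E : I → G → CStarMatrix n n A}
    (hE : IsRokhlinNet (tensorAction α β) l E) :
    ∃ p : I → G → A, IsRokhlinNet α l p ∧
      ∀ g, Tendsto (fun i => elemTensor (p i g) 1 - E i g) l (𝓝 0) := by
  classical
  obtain ⟨k⟩ := ‹Nonempty n›
  set a : I → G → A := fun i g => E i g k k
  have haE : ∀ g, Tendsto (fun i => elemTensor (a i g) 1 - E i g) l (𝓝 0) := fun g =>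
    tendsto_elemTensor_apply_sub (hE.tendsto_commutator g) k
  have hE1 : ∀ᶠ i in l, ∀ g, ‖E i g‖ ≤ 1 := hE.isStarProjection.mono fun i hi g => (hi g).norm_le
  have ha1 : ∀ᶠ i in l, ∀ g, ‖a i g‖ ≤ 1 :=
    hE1.mono fun i hi g => (CStarMatrix.norm_entry_le_norm (M := E i g)).trans (hi g)
  have hDa1 : ∀ᶠ i in l, ∀ g, ‖elemTensor (a i g) (1 : Matrix n n ℂ)‖ ≤ 1 :=
    ha1.mono fun i hi g => by rw [norm_elemTensor_one]; exact hi g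
  have hmul : ∀ g h, Tendsto (fun i => elemTensor (a i g) (1 : Matrix n n ℂ) * elemTensor (a i h) 1
      - E i g * E i h) l (𝓝 0) := by
    intro g h
    have h1 := (tendsto_mul_zero_of_bounded (hDa1.mono fun i hi => hi h) (haE g)).2.add
      (tendsto_mul_zero_of_bounded (hE1.mono fun i hi => hi g) (haE h)).1
    rw [add_zero] at h1
    exact h1.congr fun i => by noncomm_ring
  obtain ⟨p, hp, hpa⟩ := exists_orthogonal_projections (l := l) (a := a)
    (hE.isStarProjection.mono fun i hi g => by
      have h1 := congrFun (congrFun (hi g).star_eq k) k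
      exact h1)
    ha1
    (fun g => by
      refine tendsto_of_elemTensor_one (n := n) ?_
      have h1 := (hmul g g).sub (haE g)
      rw [sub_zero] at h1
      refine h1.congr' ?_
      filter_upwards [hE.isStarProjection] with i hi
      rw [(hi g).mul_self, elemTensor_sub, elemTensor_mul, one_mul]; abel)
    (fun g h hgh => by
      refine tendsto_of_elemTensor_one (n := n) ?_
      refine (hmul g h).congr' ?_
      filter_upwards [hE.orthogonal] with i hi
      rw [hi g h hgh, elemTensor_mul, one_mul, sub_zero])
    Finset.univ
  have hpE : ∀ g, Tendsto (fun i => elemTensor (p i g) 1 - E i g) l (𝓝 0) := fun g => by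
    have h1 := (tendsto_elemTensor_one (n := n) (hpa g (Finset.mem_univ g))).add (haE g)
    rw [add_zero] at h1
    exact h1.congr fun i => by rw [elemTensor_sub]; abel
  refine ⟨p, ⟨?_, ?_, fun g h => ?_, fun g b => ?_⟩, hpE⟩
  · exact hp.mono fun i hi g => hi.1 g (Finset.mem_univ g)
  · exact hp.mono fun i hi g h => hi.2 g (Finset.mem_univ g) h (Finset.mem_univ h)
  · refine tendsto_of_elemTensor_one (n := n) ?_
    have h1 : Tendsto (fun i => tensorAction α β g (elemTensor (p i h) 1 - E i h)) l (𝓝 0) := by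
      rw [tendsto_zero_iff_norm_tendsto_zero]
      simp only [StarAlgEquiv.norm_map]
      exact tendsto_zero_iff_norm_tendsto_zero.1 (hpE h)
    have h2 := (h1.add (hE.tendsto_action g h)).sub (hpE (g * h))
    rw [add_zero, sub_zero] at h2
    refine h2.congr fun i => ?_
    rw [map_sub, tensorAction_elemTensor_one, elemTensor_sub]; abel
  · refine tendsto_of_elemTensor_one (n := n) ?_
    have h1 := (((hpE g).mul_const (elemTensor b 1)).sub
      ((hpE g).const_mul (elemTensor b 1))).add (hE.tendsto_commutator g (elemTensor b 1))
    rw [zero_mul, mul_zero, sub_zero, add_zero] at h1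
    refine h1.congr fun i => ?_
    rw [elemTensor_sub, ← one_mul (1 : Matrix n n ℂ), ← elemTensor_mul, ← elemTensor_mul, one_mul]
    noncomm_ring

omit [Group G] in
theorem tendsto_elemTensor_sum_sub {p : I → G → A} {E : I → G → CStarMatrix n n A}
    (h : ∀ g, Tendsto (fun i => elemTensor (p i g) 1 - E i g) l (𝓝 0)) :
    Tendsto (fun i => elemTensor (∑ g, p i g) 1 - ∑ g, E i g) l (𝓝 0) := by
  simp only [elemTensor_sum, ← Finset.sum_sub_distrib]
  rw [← Finset.sum_const_zero (ι := G) (s := Finset.univ)]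
  exact tendsto_finsetSum _ fun g _ => h g

theorem rokhlinProperty_tensorAction_iff [Nonempty n] :
    RokhlinProperty (tensorAction α β) ↔ RokhlinProperty α := by
  classical
  constructor
  · intro h
    obtain ⟨E, hE, hE1⟩ := h.exists_net
    obtain ⟨p, hp, hpE⟩ := hE.exists_elemTensor_one
    refine hp.rokhlinProperty ?_
    have h1 : Tendsto (fun i => ∑ g, p i g - 1) atTop (𝓝 0) := by
      refine tendsto_of_elemTensor_one (n := n) ?_
      refine (tendsto_elemTensor_sum_sub hpE).congr' ?_
      filter_upwards [hE1] with i hi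
      rw [hi, elemTensor_sub, elemTensor_one_one]
    filter_upwards [eventually_norm_lt_of_tendsto_zero h1 one_pos, hp.sum] with i hi hi'
    rw [norm_sub_rev] at hi
    exact (sub_eq_zero.1 (hi'.one_sub.eq_zero_of_norm_lt hi)).symm
  · intro h
    obtain ⟨e, he, he1⟩ := h.exists_net
    refine (he.elemTensor_one (β := β)).rokhlinProperty (he1.mono fun i hi => ?_)
    rw [← elemTensor_sum, hi, elemTensor_one_one]

/-- Testing against `x ⊗ e_kk` forces the implementing partial isometry, once cut down on the right,
into the `e_kk` corner, which is a copy of `A`. -/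
theorem TracialRokhlinProperty.of_tensorAction [Nonempty n]
    (h : TracialRokhlinProperty (tensorAction α β)) : TracialRokhlinProperty α := by
  classical
  refine tracialRokhlinProperty_of_net fun x hx hx1 ε hε => ?_
  obtain ⟨k⟩ := ‹Nonempty n›
  set X : CStarMatrix n n A := elemTensor x (Matrix.single k k 1) with hX
  have hkk := (isStarProjection_single (n := n) k).isIdempotentElem.eq
  have hX0 : 0 ≤ X := by
    obtain ⟨s, rfl⟩ := CStarAlgebra.nonneg_iff_eq_star_mul_self.1 hx
    have : X = star (elemTensor s (Matrix.single k k 1)) * elemTensor s (Matrix.single k k 1) := by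
      rw [star_elemTensor, elemTensor_mul, (isStarProjection_single k).isSelfAdjoint.star_eq, hkk]
    rw [this]
    exact star_mul_self_nonneg _
  have hX1 : ‖X‖ = 1 := by rw [hX, norm_elemTensor_single, hx1]
  obtain ⟨E, hE, hv, hn⟩ := h.exists_net hX0 hX1
  obtain ⟨p, hp, hpE⟩ := hE.exists_elemTensor_one
  have hsum := tendsto_elemTensor_sum_sub hpE
  refine ⟨_, atTop, inferInstance, p, hp, ?_, ?_⟩
  · filter_upwards [hv, hp.sum, hE.sum, eventually_norm_lt_of_tendsto_zero hsum one_pos]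
      with i ⟨v, hvX, hv⟩ hP hQ hPQ
    set P := ∑ g, p i g
    set Q := ∑ g, E i g
    have hD : IsStarProjection (elemTensor (1 - P) (1 : Matrix n n ℂ)) :=
      hP.one_sub.elemTensor (.one _)
    obtain ⟨w, hw, hQw⟩ := exists_star_mul_self_eq_of_norm_sub_lt hD hQ.one_sub (by
      have : 1 - Q - elemTensor (1 - P) (1 : Matrix n n ℂ) = elemTensor P 1 - Q := by
        rw [elemTensor_sub, elemTensor_one_one]; abel
      rwa [this])
    set U : CStarMatrix n n A := elemTensor 1 (Matrix.single k k 1)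
    have hU : IsStarProjection U := (IsStarProjection.one A).elemTensor (isStarProjection_single k)
    -- `w` carries `(1 - P) ⊗ 1` under `1 - Q`, `v` carries `1 - Q` under `X`, and `U` selects one
    -- diagonal copy of `1 - P`. As `U X = X`, only the `(k,k)` entry of `V` survives.
    set V := v * w * U
    have hVX : V ∈ closedRightIdeal X :=
      mul_mem_closedRightIdeal (mul_mem_closedRightIdeal hvX w) U
    have hUX : U * X = X := by rw [elemTensor_mul, one_mul, hkk]
    have hUV : U * V * U = V := by
      rw [mul_eq_self_of_mem_closedRightIdeal hUX hVX]
      simp only [V, mul_assoc, hU.mul_self]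
    rw [single_mul_mul_single] at hUV
    have hVV : star V * V = elemTensor (1 - P) (Matrix.single k k 1) := by
      calc star V * V = U * (star w * ((star v * v) * w)) * U := by
            simp only [V, star_mul, hU.star_eq, mul_assoc]
        _ = _ := by
            rw [hv, hQw, hw, elemTensor_mul, elemTensor_mul, one_mul, mul_one, mul_one, hkk]
    refine ⟨V k k, ?_, ?_⟩
    · refine map_mem_closure (f := fun Y : CStarMatrix n n A => Y k k)
        (continuous_cstarMatrix_apply k k) hVX ?_
      rintro _ ⟨b, rfl⟩
      refine ⟨b k k, ?_⟩
      rw [hX]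
      simp only [elemTensor_single_mul_apply, if_true]
    · rw [← hUV, star_elemTensor, elemTensor_mul,
        (isStarProjection_single k).isSelfAdjoint.star_eq, hkk] at hVV
      have := congrFun (congrFun hVV k) k
      change elemTensor _ _ k k = elemTensor _ _ k k at this
      simpa [elemTensor_apply] using this
  · have hQ1 : ∀ᶠ i in atTop, ‖∑ g, E i g‖ ≤ 1 := hE.sum.mono fun i hi => hi.norm_le
    have hDP1 : ∀ᶠ i in atTop, ‖X * elemTensor (∑ g, p i g) 1‖ ≤ 1 := hp.sum.mono fun i hi =>
      (norm_mul_le _ _).trans (by rw [hX1, one_mul, norm_elemTensor_one]; exact hi.norm_le)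
    have hQX : ∀ᶠ i in atTop, ‖(∑ g, E i g) * X‖ ≤ 1 := hQ1.mono fun i hi =>
      (norm_mul_le _ _).trans (by rwa [hX1, mul_one])
    have hlim := (tendsto_mul_zero_of_bounded hDP1 hsum).2.add
      (tendsto_mul_zero_of_bounded hQX hsum).1
    rw [add_zero] at hlim
    filter_upwards [eventually_norm_lt_of_tendsto_zero hlim (half_pos hε), hn _ (half_pos hε)]
      with i h1 h2
    have h3 : ‖(∑ g, p i g) * x * ∑ g, p i g‖ =
        ‖elemTensor (∑ g, p i g) (1 : Matrix n n ℂ) * X * elemTensor (∑ g, p i g) 1‖ := by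
      rw [hX, elemTensor_mul, elemTensor_mul, one_mul, mul_one, norm_elemTensor_single]
    rw [h3]
    set D := elemTensor (∑ g, p i g) (1 : Matrix n n ℂ)
    set Q := ∑ g, E i g
    have h4 : (D - Q) * (X * D) + Q * X * (D - Q) = D * X * D - Q * X * Q := by noncomm_ring
    rw [h4, norm_sub_rev] at h1
    linarith [norm_sub_norm_le (Q * X * Q) (D * X * D)]

end Action

/-! ### Spectral cutdowns of the test element -/

section Cutdown

variable {A : Type*} [CStarAlgebra A]

/-- `W P` is close to `(P X P)(W P)`: replacing `W` by `X W` costs `δ`, and each of the two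
commutations of `P` past `W` costs `η`. -/
theorem norm_sub_lt_norm_mul_mul {P X W : A} {δ η : ℝ} (hP : IsStarProjection P) (hX : ‖X‖ = 1)
    (hW : ‖W‖ ≤ 1) (hXW : ‖X * W - W‖ ≤ δ) (hPW : ‖P * W - W * P‖ < η) :
    ‖W * P‖ - δ - 2 * η < ‖P * X * P‖ := by
  have hP1 := hP.norm_le
  have e : W * P = (P * X * P) * (W * P) - P * X * ((P * W - W * P) * P) - P * (X * W - W) * P
      - (P * W - W * P) * P := by
    have h1 : P * W * P * P = P * W * P := by rw [mul_assoc _ P P, hP.mul_self]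
    have h2 : W * P * P = W * P := by rw [mul_assoc _ P P, hP.mul_self]
    have h3 : P * X * (W * P * P) = P * X * (W * P) := by rw [h2]
    calc W * P = P * X * (W * P) - (P * X * (W * P) - P * W * P) - (P * W * P - W * P) := by abel
      _ = P * X * (W * P * P) - (P * X * (W * P) - P * W * P) - (P * W * P - W * P * P) := by
        rw [h2]
      _ = _ := by noncomm_ring
  have b1 : ‖(P * X * P) * (W * P)‖ ≤ ‖P * X * P‖ := by
    refine (norm_mul_le _ _).trans (mul_le_of_le_one_right (norm_nonneg _) ?_)
    exact (norm_mul_le _ _).trans (mul_le_one₀ hW (norm_nonneg _) hP1)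
  have b2 : ‖(P * W - W * P) * P‖ ≤ ‖P * W - W * P‖ :=
    (norm_mul_le _ _).trans (mul_le_of_le_one_right (norm_nonneg _) hP1)
  have b3 : ‖P * X * ((P * W - W * P) * P)‖ ≤ ‖P * W - W * P‖ := by
    refine (norm_mul_le _ _).trans ((mul_le_of_le_one_left (norm_nonneg _) ?_).trans b2)
    exact (norm_mul_le _ _).trans (by rw [hX, mul_one]; exact hP1)
  have b4 : ‖P * (X * W - W) * P‖ ≤ δ := by
    refine (norm_mul_le _ _).trans ((mul_le_of_le_one_right (norm_nonneg _) hP1).trans ?_)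
    exact (norm_mul_le _ _).trans ((mul_le_of_le_one_left (norm_nonneg _) hP1).trans hXW)
  have b5 : ‖W * P‖ ≤ ‖(P * X * P) * (W * P)‖ + ‖P * X * ((P * W - W * P) * P)‖ +
      ‖P * (X * W - W) * P‖ + ‖(P * W - W * P) * P‖ := by
    conv_lhs => rw [e]
    refine (norm_sub_le _ _).trans (add_le_add ((norm_sub_le _ _).trans
      (add_le_add (norm_sub_le _ _) le_rfl)) le_rfl)
  linarith

variable [PartialOrder A] [StarOrderedRing A]

/-- Functional calculus of a positive element of norm one near the top of its spectrum. -/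
theorem exists_mul_eq_and_norm_mul_sub_le {x : A} (hx : 0 ≤ x) (hx1 : ‖x‖ = 1) {δ : ℝ}
    (hδ : 0 < δ) :
    ∃ h g, h ≠ 0 ∧ h ∈ closedRightIdeal x ∧ g * h = h ∧ ‖x * g - g‖ ≤ δ := by
  have hnt : Nontrivial A := ⟨⟨x, 0, by rintro rfl; simp at hx1⟩⟩
  have hxs : IsSelfAdjoint x := hx.isSelfAdjoint
  -- `f` lives above `1 - δ/2`, where `k = 1`, while `k` vanishes below `1 - δ`. The factor `t` in
  -- `t f(t)` puts `h` into the right ideal of `x`.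
  let f : ℝ → ℝ := fun t => max 0 (t - (1 - δ / 2))
  let k : ℝ → ℝ := fun t => min 1 (max 0 ((t - (1 - δ)) * (2 / δ)))
  have hf : Continuous f := by fun_prop
  have hk : Continuous k := by fun_prop
  have hkf : ∀ t, k t * (t * f t) = t * f t := by
    intro t
    by_cases ht : t ≤ 1 - δ / 2
    · have : f t = 0 := max_eq_left (by linarith)
      rw [this]; ring
    · have h1 : 1 ≤ (t - (1 - δ)) * (2 / δ) := by
        rw [mul_div_assoc', le_div_iff₀ hδ]; linarith
      have : k t = 1 := by
        simp only [k]
        rw [max_eq_right (by linarith), min_eq_left h1]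
      rw [this, one_mul]
  refine ⟨cfc (fun t => t * f t) x, cfc k x, ?_, ?_, ?_, ?_⟩
  · intro h0
    have h1 : (1 : ℝ) ∈ spectrum ℝ x := by
      have := CStarAlgebra.norm_mem_spectrum_of_nonneg (a := x) hx
      rwa [hx1] at this
    have h2 := norm_apply_le_norm_cfc (fun t => t * f t) x h1
    rw [h0, norm_zero, one_mul, norm_le_zero_iff] at h2
    have h3 : f 1 = δ / 2 := by
      simp only [f]; rw [max_eq_right (by linarith)]; ring
    linarith
  · rw [cfc_mul (fun t => t) f x, cfc_id' ℝ x]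
    exact mul_self_mem_closedRightIdeal _ _
  · rw [← cfc_mul k (fun t => t * f t) x]
    simp only [hkf]
  · have h1 : x * cfc k x - cfc k x = cfc (fun t => t * k t - k t) x := by
      rw [cfc_sub (fun t => t * k t) k x, cfc_mul (fun t => t) k x, cfc_id' ℝ x]
    rw [h1]
    refine norm_cfc_le hδ.le fun t ht => ?_
    have h2 : t ≤ 1 := by
      have := spectrum.norm_le_norm_of_mem ht
      rw [hx1, Real.norm_eq_abs] at this
      exact (le_abs_self t).trans this
    have hk0 : 0 ≤ k t := le_min zero_le_one (le_max_left _ _)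
    have hk1 : k t ≤ 1 := min_le_left _ _
    have h3 : ‖t * k t - k t‖ = (1 - t) * k t := by
      rw [Real.norm_eq_abs, abs_sub_comm, abs_of_nonneg (by nlinarith)]; ring
    rw [h3]
    by_cases ht' : t ≤ 1 - δ
    · have : k t = 0 := by
        simp only [k]
        rw [max_eq_left (mul_nonpos_of_nonpos_of_nonneg (by linarith) (by positivity)),
          min_eq_right zero_le_one]
      rw [this, mul_zero]; exact hδ.le
    · nlinarith

variable {n : Type*} [Fintype n] [DecidableEq n]

/-- A nonzero column of `h`, moved to position `k₀`, has square `a ⊗ e` with `a ≥ 0` nonzero in `A`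
and `e` a diagonal matrix unit. So (SP) is needed only in `A`, not in the matrix algebra. -/
theorem PropertySP.exists_star_mul_self_eq_elemTensor (hA : PropertySP A) {h : CStarMatrix n n A}
    (hh : h ≠ 0) (k₀ : n) :
    ∃ q c, IsStarProjection q ∧ q ≠ 0 ∧
      star (h * c) * (h * c) = elemTensor q (Matrix.single k₀ k₀ 1) := by
  obtain ⟨r, k, hrk⟩ : ∃ r k, h r k ≠ 0 := by
    by_contra! h0
    exact hh (by ext r k; exact h0 r k)
  have hU := isStarProjection_single (n := n) k₀
  have hkk := hU.isIdempotentElem.eq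
  set w : CStarMatrix n n A := h * elemTensor 1 (Matrix.single k k₀ 1) with hw
  set a : A := ∑ s, star (h s k) * h s k with ha
  have hww : star w * w = elemTensor a (Matrix.single k₀ k₀ 1) := by
    have hws : ∀ s j, w s j = if k₀ = j then h s k else 0 := fun s j => by
      rw [hw, mul_elemTensor_single_apply, mul_one]
    ext i j
    rw [CStarMatrix.mul_apply, elemTensor_apply, Matrix.single_apply]
    simp only [CStarMatrix.star_apply, hws]
    rcases eq_or_ne k₀ i with rfl | hi
    · rcases eq_or_ne k₀ j with rfl | hj
      · simp [ha]
      · simp [hj]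
    · simp [hi]
  have ha0 : 0 ≤ a := Finset.sum_nonneg fun s _ => star_mul_self_nonneg _
  have ha1 : a ≠ 0 := by
    intro h0
    have h1 := (Finset.sum_eq_zero_iff_of_nonneg fun s _ => star_mul_self_nonneg (h s k)).1 h0 r
      (Finset.mem_univ r)
    exact hrk ((CStarRing.star_mul_self_eq_zero_iff _).1 h1)
  obtain ⟨q, hqa, hq, hq0⟩ := hA a ha0 ha1
  obtain ⟨m, hm⟩ := exists_norm_mul_sub_lt_one hqa
  obtain ⟨c, hc⟩ := exists_star_mul_self_eq (b := w)
    (m := elemTensor (star m) (Matrix.single k₀ k₀ 1) * star w) (hq.elemTensor hU) (by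
      have h1 : elemTensor (star m) (Matrix.single k₀ k₀ 1) * star w * w *
          elemTensor q (Matrix.single k₀ k₀ 1) - elemTensor q (Matrix.single k₀ k₀ 1) =
          elemTensor (star (a * m - q) * q) (Matrix.single k₀ k₀ 1) := by
        rw [mul_assoc _ (star w), hww, elemTensor_mul, elemTensor_mul, hkk, hkk, ← elemTensor_sub,
          star_sub, star_mul, ha0.isSelfAdjoint.star_eq, hq.star_eq, sub_mul, hq.mul_self]
      rw [h1, norm_elemTensor_single]
      refine (norm_mul_le _ _).trans_lt ?_
      rw [norm_star]
      exact (mul_le_of_le_one_right (norm_nonneg _) hq.norm_le).trans_lt hm)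
  refine ⟨q, elemTensor 1 (Matrix.single k k₀ 1) * elemTensor q (Matrix.single k₀ k₀ 1) * c,
    hq, hq0, Eq.trans ?_ hc⟩
  simp only [hw, mul_assoc]

end Cutdown

/-! ### Assembling a row of orthogonal copies -/

section Row

variable {A : Type*} [CStarAlgebra A] {n : Type*} [Fintype n] [DecidableEq n]

theorem star_row_mul_row {Z : CStarMatrix n n A} {k : n} {q b : A} {v : n → A}
    (hZ : star Z * Z = elemTensor q (Matrix.single k k 1))
    (hv : ∀ i j, star (v i) * q * v j = if i = j then b else 0) :
    star (Z * ∑ j, elemTensor (v j) (Matrix.single k j 1)) *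
      (Z * ∑ j, elemTensor (v j) (Matrix.single k j 1)) = elemTensor b 1 := by
  rw [star_mul, mul_assoc, ← mul_assoc (star Z), hZ, star_sum, Finset.sum_mul,
    ← sum_elemTensor_single]
  refine Finset.sum_congr rfl fun i _ => ?_
  rw [Finset.mul_sum, Finset.mul_sum, Finset.sum_eq_single_of_mem i (Finset.mem_univ i)]
  · rw [star_elemTensor, elemTensor_mul, elemTensor_mul, ← mul_assoc, hv, if_pos rfl]
    congr 1
    simp [Matrix.star_eq_conjTranspose]
  · intro j _ hj
    rw [star_elemTensor, elemTensor_mul, elemTensor_mul, ← mul_assoc, hv, if_neg hj.symm,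
      zero_elemTensor]

end Row

/-! ### Ascent of the tracial Rokhlin property -/

section Main

variable {G A : Type*} [Group G] [Fintype G] [CStarAlgebra A] [PartialOrder A] [StarOrderedRing A]

theorem TracialRokhlinProperty.tensorAction (hA : IsSimpleCStarAlgebra A) {n : ℕ}
    {α : G →* (A ≃⋆ₐ[ℂ] A)}
    {β : G →* (Matrix (Fin (n + 1)) (Fin (n + 1)) ℂ ≃⋆ₐ[ℂ] Matrix (Fin (n + 1)) (Fin (n + 1)) ℂ)}
    (hα : TracialRokhlinProperty α) : TracialRokhlinProperty (tensorAction α β) := by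
  classical
  by_cases hR : RokhlinProperty α
  · exact (rokhlinProperty_tensorAction_iff.2 hR).tracialRokhlinProperty
  have hSP := hα.propertySP hR
  refine tracialRokhlinProperty_of_net fun X hX hX1 ε hε => ?_
  obtain ⟨h, g, hh0, hhX, hgh, hXg⟩ :=
    exists_mul_eq_and_norm_mul_sub_le hX hX1 (by positivity : 0 < ε / 4)
  obtain ⟨q, c, hq, hq0, hZ⟩ := hSP.exists_star_mul_self_eq_elemTensor hh0 0
  obtain ⟨p, v, hp, hp0, hqv, hv⟩ := hSP.exists_orthogonal_family hA
    (fun r hr hr0 => hα.exists_proper_subprojection hA hR hr hr0) n hq hq0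
  obtain ⟨e, he, hu, hn⟩ := hα.exists_net hp.nonneg (hp.norm_eq_one hp0)
  have he' := he.elemTensor_one (β := β)
  refine ⟨_, atTop, inferInstance, _, he', ?_, ?_⟩
  · filter_upwards [hu] with i ⟨u, hup, hu⟩
    -- Each `u` carries `1 - e` under `p`, and `v j` carries `p` to the `j`-th orthogonal copy under
    -- `q`. Placing copy `j` in column `j` sends all of `(1 - e) ⊗ 1` under `X`.
    refine ⟨h * c * ∑ j, elemTensor (v j * u) (Matrix.single 0 j 1),
      mul_mem_closedRightIdeal (mul_mem_closedRightIdeal hhX c) _, ?_⟩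
    rw [← elemTensor_sum, ← elemTensor_one_one, ← elemTensor_sub]
    have hpu : p * u = u := mul_eq_self_of_mem_closedRightIdeal hp.mul_self hup
    refine star_row_mul_row hZ fun i j => ?_
    have : star (v i * u) * q * (v j * u) = star u * (star (v i) * v j * u) := by
      rw [star_mul]; simp only [mul_assoc]; rw [← mul_assoc q, hqv]
    rw [this, hv]
    split_ifs
    · rw [hpu, hu]
    · simp
  -- A partial isometry with initial projection `p ⊗ e_00` on whose range `X` is almost the
  -- identity. It turns the lower bound on `‖e p e‖` into one on `‖P X P‖`.
  · set W := h * c * elemTensor (v 0) (Matrix.single 0 0 1)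
    have hU := isStarProjection_single (n := Fin (n + 1)) 0
    have hWW : star W * W = elemTensor p (Matrix.single 0 0 1) := by
      calc star W * W = star (elemTensor (v 0) (Matrix.single 0 0 1)) *
            (star (h * c) * (h * c)) * elemTensor (v 0) (Matrix.single 0 0 1) := by
            simp only [W, star_mul, mul_assoc]
        _ = _ := by
            rw [hZ, star_elemTensor, hU.isSelfAdjoint.star_eq, elemTensor_mul, elemTensor_mul,
              hU.isIdempotentElem.eq, hU.isIdempotentElem.eq, mul_assoc, hqv, hv, if_pos rfl]
    have hW1 : ‖W‖ ≤ 1 := by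
      have h1 : ‖W‖ * ‖W‖ = 1 := by
        rw [← CStarRing.norm_star_mul_self, hWW, norm_elemTensor_single, hp.norm_eq_one hp0]
      nlinarith [norm_nonneg W]
    have hgW : g * W = W := by simp only [W, ← mul_assoc, hgh]
    have hXW : ‖X * W - W‖ ≤ ε / 4 := by
      have : X * W - W = (X * g - g) * W := by rw [sub_mul, mul_assoc, hgW]
      rw [this]
      exact (norm_mul_le _ _).trans ((mul_le_of_le_one_right (norm_nonneg _) hW1).trans hXg)
    filter_upwards [he'.sum, he.sum, hn (ε / 4) (by positivity),
      eventually_norm_lt_of_tendsto_zero (he'.tendsto_commutator_sum W)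
        (by positivity : 0 < ε / 8)] with i hP hE h1 h2
    have h3 := norm_sub_lt_norm_mul_mul hP hX1 hW1 hXW h2
    refine lt_trans ?_ h3
    set P := ∑ g, elemTensor (e i g) (1 : Matrix (Fin (n + 1)) (Fin (n + 1)) ℂ) with hPdef
    have h4 : ‖W * P‖ * ‖W * P‖ = ‖(∑ g, e i g) * p * ∑ g, e i g‖ := by
      rw [← CStarRing.norm_star_mul_self, star_mul, hP.star_eq, mul_assoc, ← mul_assoc (star W),
        hWW, hPdef, ← elemTensor_sum, elemTensor_mul, elemTensor_mul, mul_one, one_mul,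
        norm_elemTensor_single, mul_assoc]
    have h5 : ‖W * P‖ ≤ 1 :=
      (norm_mul_le _ _).trans (mul_le_one₀ hW1 (norm_nonneg _) hP.norm_le)
    -- As `‖W P‖ ≤ 1`, it is at least its square, which exceeds `1 - ε/4`; the losses `ε/4` and `2 ·
    -- ε/8` leave `1 - 3ε/4`.
    nlinarith [norm_nonneg (W * P)]

end Main

end

theorem proposition2 {G : Type*} [Group G] [Fintype G]
    {A : Type*} [CStarAlgebra A] [PartialOrder A] [StarOrderedRing A]
    (hA : IsSimpleCStarAlgebra A) (n : ℕ) (hn : 1 ≤ n)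
    (α : G →* (A ≃⋆ₐ[ℂ] A))
    (β : G →* (Matrix (Fin n) (Fin n) ℂ ≃⋆ₐ[ℂ] Matrix (Fin n) (Fin n) ℂ)) :
    (TracialRokhlinProperty α ↔ TracialRokhlinProperty (tensorAction α β)) ∧
    (RokhlinProperty α ↔ RokhlinProperty (tensorAction α β)) := by
  obtain ⟨n, rfl⟩ := Nat.exists_eq_add_of_le' hn
  exact ⟨⟨fun h => h.tensorAction hA, fun h => h.of_tensorAction⟩,
    rokhlinProperty_tensorAction_iff.symm⟩
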